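/- Let $d\ge1$, $\mathbb{T}^d=(\mathbb{R}/2\pi\mathbb{Z})^d$, $\gamma>d/2$ and $T>0$. For $s\ge 0$ let $\|f\|_{H^s}=(2\pi)^{d/2}\big(\sum_{\xi\in\mathbb{Z}^d}(1+|\xi|^2)^{s}|\hat f(\xi)|^2\big)^{1/2}$ with $\hat f(\xi)=(2\pi)^{-d}\int_{\mathbb{T}^d}e^{-ix\cdot\xi}f(x)\,dx$, and for a function $F$ let $F(\Delta)$ be the operator that multiplies $\hat f(\xi)$ by $F(-|\xi|^2)$. Put $$\varphi(z)=\frac{e^z-1}{z}\ (z\ne0),\quad \varphi(0)=1,\qquad \psi(z)=\frac{e^z-1-ze^z}{z^2}\ (z\neq0),\quad \psi(0)=-\tfrac12 .$$ Let $u_0\in H^{\gamma+2}(\mathbb{T}^d)$ and let $u\in L^\infty(0,T;H^{\gamma+2}(\mathbb{T}^d))$ be a solution on $[0,T]$ of the cubic nonlinear Schrödinger equation $$i\partial_tu+\Delta u+|u|^2u=0,\qquad u(0)=u_0 ,$$ that is, $u\in C([0,T];L^2(\mathbb{T}^d))$, $u(0)=u_0$, and for every $\xi\in\mathbb{Z}^d$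 and $t\in(0,T)$ the function $\hat u(\cdot,\xi)$ is differentiable at $t$ with $i\partial_t\hat u(t,\xi)-|\xi|^2\hat u(t,\xi)+\widehat{|u|^2u}(t,\xi)=0$. For a step size $\tau>0$ define $u^0=u_0$ and, for $n\ge0$, $$u^{n+1}=e^{i\tau\Delta}u^n+i\tau e^{i\tau\Delta}\Big\{\big(\big[\varphi(-2i\tau\Delta)+\psi(-2i\tau\Delta)\big]\overline{u^n}\big)\cdot(u^n)^2\Big\}-i\tau\big[e^{i\tau\Delta}\psi(-2i\tau\Delta)\overline{u^n}\big]\cdot\big(e^{i\tau\Delta}u^n\big)^2-\frac{\tau^2}{2}e^{i\tau\Delta}\Big[|u^n|^4u^n\Big].$$ Then there are constants $\tau_0,C>0$ such that $$\|u(n\tau)-u^n\|_{H^\gamma}\le C\tau^2\qquad\text{for all } 0<\tau\le\tau_0 \text{ and all integers } n\ge0 \text{ with } n\tau\le T .$$ For fixed $d$ and $\gamma$, the constants $\tau_0$ and $C$ depend only on $T$ and $\|u\|_{L^\infty(0,T;H^{\gamma+2})}$; more precisely, for every $M\ge0$ they can be chosen to be the same for all $u_0$ and $u$ as above with $\|u\|_{L^\infty(0,T;H^{\gamma+2})}\le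 M$. -/

import Mathlib

open MeasureTheory
open scoped ENNReal NNReal ComplexConjugate

noncomputable section

namespace CubicNLS

/-- The period `2π` is positive, so that `ℝ / 2πℤ` carries its Lebesgue measure of mass `2π`. -/
instance two_pi_pos_fact : Fact ((0 : ℝ) < 2 * Real.pi) := ⟨Real.two_pi_pos⟩

/-- The torus `𝕋^d = (ℝ / 2πℤ)^d`; `volume` is the product Lebesgue measure, of mass `(2π)^d`. -/
abbrev Torus (d : ℕ) : Type := Fin d → AddCircle (2 * Real.pi)

/-- The complex Hilbert space `L²(𝕋^d)`. -/
abbrev L2 (d : ℕ) : Type := Lp ℂ 2 (volume : Measure (Torus d))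

/-- The Fourier mode `x ↦ e^{i x·ξ}`, for `ξ ∈ ℤ^d`. -/
def mode {d : ℕ} (ξ : Fin d → ℤ) (x : Torus d) : ℂ := ∏ j, fourier (ξ j) (x j)

/-- The Fourier coefficient `(2π)^{-d} ∫ e^{-i x·ξ} f(x) dx`. -/
def coeff {d : ℕ} (f : Torus d → ℂ) (ξ : Fin d → ℤ) : ℂ :=
  ((2 * Real.pi : ℝ) : ℂ)⁻¹ ^ d * ∫ x, conj (mode ξ x) * f x

/-- `|ξ|² = ξ·ξ`. -/
def freqSq {d : ℕ} (ξ : Fin d → ℤ) : ℝ := ∑ j, (ξ j : ℝ) ^ 2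

/-- The norm `(2π)^{d/2} (∑_ξ (1 + |ξ|²)^s |f̂(ξ)|²)^{1/2}` of `H^s(𝕋^d)`, with value `∞` when `f`
does not belong to `H^s(𝕋^d)`. -/
def sobolevNorm {d : ℕ} (s : ℝ) (f : L2 d) : ℝ≥0∞ :=
  ENNReal.ofReal ((2 * Real.pi) ^ ((d : ℝ) / 2)) *
    (∑' ξ : Fin d → ℤ, ENNReal.ofReal ((1 + freqSq ξ) ^ s * ‖coeff f ξ‖ ^ 2)) ^ ((1 : ℝ) / 2)

/-- The Sobolev space `H^s(𝕋^d)`, `s ≥ 0`, as a subset of `L²(𝕋^d)`. -/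
def sobolev (d : ℕ) (s : ℝ) : Set (L2 d) := {f | sobolevNorm s f < ∞}

open Classical in
/-- The operator `F(Δ)` on `L²(𝕋^d)`: it multiplies the Fourier coefficient at `ξ` by `F(-|ξ|²)`.
The element of `L²` with the new coefficients is unique, and it exists for every `f` in the domain
of `F(Δ)`, hence for every `f` when `F` is bounded on `(-∞, 0]`. (The value is `0` off the
domain.) -/
def funLaplacian {d : ℕ} (F : ℂ → ℂ) (f : L2 d) : L2 d :=
  if h : ∃ g : L2 d, ∀ ξ, coeff g ξ = F (-(freqSq ξ : ℂ)) * coeff f ξ then h.choose else 0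

open Classical in
/-- A square-integrable function, as an element of `L²(𝕋^d)` (and `0` for all other functions). -/
def toL2 {d : ℕ} (f : Torus d → ℂ) : L2 d :=
  if h : MemLp f 2 (volume : Measure (Torus d)) then h.toLp f else 0

/-- `φ(z) = (e^z - 1) / z`, `φ(0) = 1`. -/
def phi (z : ℂ) : ℂ := if z = 0 then 1 else (Complex.exp z - 1) / z

/-- `ψ(z) = (e^z - 1 - z e^z) / z²`, `ψ(0) = -1/2`. -/
def psi (z : ℂ) : ℂ := if z = 0 then -1 / 2 else (Complex.exp z - 1 - z * Complex.exp z) / z ^ 2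

/-- The free Schrödinger propagator `e^{iτΔ}`. -/
def propagator {d : ℕ} (τ : ℝ) : L2 d → L2 d := funLaplacian fun z => Complex.exp (Complex.I * τ * z)

/-- The operator `φ(-2iτΔ)`. -/
def phiOp {d : ℕ} (τ : ℝ) : L2 d → L2 d := funLaplacian fun z => phi (-2 * Complex.I * τ * z)

/-- The operator `ψ(-2iτΔ)`. -/
def psiOp {d : ℕ} (τ : ℝ) : L2 d → L2 d := funLaplacian fun z => psi (-2 * Complex.I * τ * z)

/-- The complex conjugate `x ↦ conj (f x)`. -/
def conjL2 {d : ℕ} (f : L2 d) : L2 d := toL2 fun x => conj (f x)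

/-- One step of size `τ` of the scheme:
`e^{iτΔ}w + iτ e^{iτΔ}{([φ(-2iτΔ) + ψ(-2iτΔ)] w̄) w²} - iτ (e^{iτΔ} ψ(-2iτΔ) w̄) (e^{iτΔ}w)²
  - (τ²/2) e^{iτΔ}(|w|⁴ w)`. -/
def lriStep {d : ℕ} (τ : ℝ) (w : L2 d) : L2 d :=
  propagator τ w
    + (Complex.I * τ) •
        propagator τ (toL2 fun x => (phiOp τ (conjL2 w) + psiOp τ (conjL2 w)) x * w x ^ 2)
    - (Complex.I * τ) •
        toL2 (fun x => propagator τ (psiOp τ (conjL2 w)) x * propagator τ w x ^ 2)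
    - ((τ : ℂ) ^ 2 / 2) • propagator τ (toL2 fun x => (‖w x‖ : ℂ) ^ 4 * w x)

/-- The numerical solution `u^n` with step size `τ` and `u^0 = u₀`. -/
def lri {d : ℕ} (τ : ℝ) (u₀ : L2 d) : ℕ → L2 d
  | 0 => u₀
  | n + 1 => lriStep τ (lri τ u₀ n)

/-- `u` is a solution on `[0, T]` of `i ∂ₜu + Δu + |u|²u = 0`, `u(0) = u₀`: it is continuous in time
with values in `L²`, takes the initial value, and satisfies the equation weakly in space, i.e.
after it has been tested against each `e^{i x·ξ}`. (As the test functions are the Fourier modes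
only, every stronger notion of solution implies this one.) -/
structure IsSolution {d : ℕ} (T : ℝ) (u₀ : L2 d) (u : ℝ → L2 d) : Prop where
  continuousOn : ContinuousOn u (Set.Icc 0 T)
  initial : u 0 = u₀
  equation : ∀ t ∈ Set.Ioo 0 T, ∀ ξ : Fin d → ℤ, ∃ v : ℂ,
    HasDerivAt (fun s => coeff (u s) ξ) v t ∧
      Complex.I * v + (-(freqSq ξ : ℂ)) * coeff (u t) ξ
        + coeff (fun x => (‖u t x‖ : ℂ) ^ 2 * u t x) ξ = 0

/-- The norm of `L^∞((0, T); H^s(𝕋^d))`. -/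
def supSobolevNorm {d : ℕ} (s T : ℝ) (u : ℝ → L2 d) : ℝ≥0∞ :=
  essSup (fun t => sobolevNorm s (u t)) (volume.restrict (Set.Ioo 0 T))

end CubicNLS

end

/-!
Write `v(t) = e^{-itΔ}u(t)`. On the Fourier side `v` solves `∂ₜv = i N_t(v)`, where `N_t` is the
trilinear convolution `|v|²v` with symbol `e^{it(2|ξ|² + β)}`, `ξ` being the frequency carried by
the conjugated factor and `β` a sum of products of pairs of distinct frequencies. On `[0, τ]` the
symbol is replaced by `e^{2is|ξ|²}(1 + (s/τ)(e^{iτβ} - 1))`, which is exact at `s = 0` and at the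
full phase `τβ`, so that its error is `O(τ²β²)`; since `β` contains no square of a frequency, this
costs two derivatives on each factor at most. The replaced symbol is the one that integrates to
`φ` and `ψ`, and the linear part of `v(s) - v(0)` contributes `-(τ²/2)|u|⁴u`. Hence the local error
is `O(τ³)` in `H^γ` when `u` is bounded in `H^{γ+2}`. As `H^γ` is an algebra for `γ > d/2`, one
step is Lipschitz with constant `1 + O(τ)` on bounded sets of `H^γ`, and a discrete Gronwall
argument, which at the same time keeps the numerical solution bounded, gives the error `O(τ²)`.
-/

noncomputable section

namespace CubicNLS

/-! ### Sequences and convolutions -/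

section L2Norm

variable {ι : Type*}

/-- The `ℓ²` norm of a nonnegative sequence. -/
def l2 (f : ι → ℝ≥0∞) : ℝ≥0∞ := (∑' i, f i ^ 2) ^ ((1 : ℝ) / 2)

lemma l2_sq (f : ι → ℝ≥0∞) : l2 f ^ 2 = ∑' i, f i ^ 2 := by
  rw [l2, ← ENNReal.rpow_natCast, ← ENNReal.rpow_mul]; norm_num

lemma l2_mono {f g : ι → ℝ≥0∞} (h : f ≤ g) : l2 f ≤ l2 g :=
  ENNReal.rpow_le_rpow (ENNReal.tsum_le_tsum fun i => pow_le_pow_left' (h i) 2) (by norm_num)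

lemma l2_const_mul (c : ℝ≥0∞) (f : ι → ℝ≥0∞) : l2 (fun i => c * f i) = c * l2 f := by
  refine (ENNReal.pow_right_strictMono two_ne_zero).injective ?_
  simp only [mul_pow, l2_sq, ENNReal.tsum_mul_left]

lemma l2_comp_equiv {κ : Type*} (e : κ ≃ ι) (f : ι → ℝ≥0∞) : l2 (fun i => f (e i)) = l2 f := by
  rw [l2, l2, e.tsum_eq (fun i => f i ^ 2)]

lemma tsum_mul_le_l2_mul_l2 (f g : ι → ℝ≥0∞) : ∑' i, f i * g i ≤ l2 f * l2 g := by
  let _ : MeasurableSpace ι := ⊤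
  have := ENNReal.lintegral_mul_le_Lp_mul_Lq (Measure.count : Measure ι)
    Real.HolderConjugate.two_two (f := f) (g := g) (by fun_prop) (by fun_prop)
  simpa [lintegral_count, l2] using this

lemma tsum_le_l2_mul_l2 {v w : ι → ℝ≥0∞} (hvw : ∀ i, v i * w i = 1) (f : ι → ℝ≥0∞) :
    ∑' i, f i ≤ l2 v * l2 fun i => w i * f i := by
  simpa only [← mul_assoc, hvw, one_mul] using tsum_mul_le_l2_mul_l2 v fun i => w i * f i

lemma l2_add_le (f g : ι → ℝ≥0∞) : l2 (fun i => f i + g i) ≤ l2 f + l2 g := by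
  let _ : MeasurableSpace ι := ⊤
  have := ENNReal.lintegral_Lp_add_le (μ := (Measure.count : Measure ι)) (f := f) (g := g)
    (by fun_prop) (by fun_prop) (p := 2) (by norm_num)
  simpa [lintegral_count, l2] using this

lemma tsum_mul_sq_le (f g : ι → ℝ≥0∞) :
    (∑' i, f i * g i) ^ 2 ≤ (∑' i, f i) * ∑' i, f i * g i ^ 2 := by
  have hsqrt (x : ℝ≥0∞) : (x ^ ((1 : ℝ) / 2)) ^ 2 = x := by
    rw [← ENNReal.rpow_natCast, ← ENNReal.rpow_mul]; norm_num
  calc (∑' i, f i * g i) ^ 2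
      = (∑' i, f i ^ ((1 : ℝ) / 2) * (f i ^ ((1 : ℝ) / 2) * g i)) ^ 2 := by
        simp only [← mul_assoc, ← sq, hsqrt]
    _ ≤ (l2 (fun i => f i ^ ((1 : ℝ) / 2)) * l2 fun i => f i ^ ((1 : ℝ) / 2) * g i) ^ 2 := by
        gcongr; exact tsum_mul_le_l2_mul_l2 _ _
    _ = (∑' i, f i) * ∑' i, f i * g i ^ 2 := by simp only [mul_pow, l2_sq, hsqrt]

lemma summable_iff_tsum_enorm_ne_top {a : ι → ℂ} : Summable a ↔ ∑' i, ‖a i‖ₑ ≠ ∞ := by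
  rw [← summable_norm_iff]
  refine ⟨fun h => ?_, fun h => ?_⟩
  · simpa only [ofReal_norm] using h.tsum_ofReal_ne_top
  · simpa only [toReal_enorm] using ENNReal.summable_toReal h

end L2Norm

section Convolution

variable {G : Type*} [AddCommGroup G]

/-- The convolution of nonnegative sequences. -/
def conv (f g : G → ℝ≥0∞) (ξ : G) : ℝ≥0∞ := ∑' η, f η * g (ξ - η)

lemma conv_comm (f g : G → ℝ≥0∞) : conv f g = conv g f := by
  ext ξ
  rw [conv, conv, ← (Equiv.subLeft ξ).tsum_eq]
  simp [mul_comm]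

lemma tsum_conv (f g : G → ℝ≥0∞) : ∑' ξ, conv f g ξ = (∑' ξ, f ξ) * ∑' ξ, g ξ := by
  simp only [conv]
  rw [ENNReal.tsum_comm, ← ENNReal.tsum_mul_right]
  refine tsum_congr fun η => ?_
  rw [ENNReal.tsum_mul_left]
  exact congrArg _ ((Equiv.subRight η).tsum_eq g)

lemma tsum_prod_eq_conv_conv (f g h : G → ℝ≥0∞) (ξ : G) :
    ∑' p : G × G, f p.1 * g p.2 * h (ξ - p.1 - p.2) = conv f (conv g h) ξ := by
  rw [ENNReal.tsum_prod']
  simp only [conv, ← ENNReal.tsum_mul_left, mul_assoc]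

lemma l2_conv_le (f g : G → ℝ≥0∞) : l2 (conv f g) ≤ (∑' ξ, f ξ) * l2 g := by
  refine (ENNReal.pow_le_pow_left_iff two_ne_zero).mp ?_
  calc l2 (conv f g) ^ 2
      = ∑' ξ, conv f g ξ ^ 2 := l2_sq _
    _ ≤ ∑' ξ, (∑' η, f η) * conv f (fun η => g η ^ 2) ξ :=
        ENNReal.tsum_le_tsum fun ξ => tsum_mul_sq_le f fun η => g (ξ - η)
    _ = ((∑' ξ, f ξ) * l2 g) ^ 2 := by
        rw [ENNReal.tsum_mul_left, tsum_conv, mul_pow, l2_sq]; ring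

variable {w v : G → ℝ≥0∞} {c : ℝ≥0∞}

/-- The weight goes to one of the two factors, and the other one is in `ℓ¹`. -/
lemma l2_mul_conv_le (hw : ∀ ξ η, w (ξ + η) ≤ c * (w ξ + w η)) (hvw : ∀ ξ, v ξ * w ξ = 1)
    (f g : G → ℝ≥0∞) :
    l2 (fun ξ => w ξ * conv f g ξ)
      ≤ 2 * c * l2 v * (l2 (fun ξ => w ξ * f ξ) * l2 fun ξ => w ξ * g ξ) := by
  set wf := fun ξ => w ξ * f ξ
  set wg := fun ξ => w ξ * g ξ
  have weight_split (ξ : G) : w ξ * conv f g ξ ≤ c * (conv g wf ξ + conv f wg ξ) := by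
    rw [conv_comm g]
    simp only [conv, ← ENNReal.tsum_mul_left, ← ENNReal.tsum_add]
    refine ENNReal.tsum_le_tsum fun η => ?_
    calc w ξ * (f η * g (ξ - η))
        ≤ c * (w η + w (ξ - η)) * (f η * g (ξ - η)) := by
          gcongr
          simpa using hw η (ξ - η)
      _ = c * (wf η * g (ξ - η) + f η * wg (ξ - η)) := by ring
  calc l2 (fun ξ => w ξ * conv f g ξ)
      ≤ c * l2 (fun ξ => conv g wf ξ + conv f wg ξ) := by
        rw [← l2_const_mul]; exact l2_mono weight_split
    _ ≤ c * (l2 (conv g wf) + l2 (conv f wg)) := by gcongr; exact l2_add_le _ _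
    _ ≤ c * (l2 v * l2 wg * l2 wf + l2 v * l2 wf * l2 wg) := by
        gcongr
        · exact (l2_conv_le _ _).trans (by gcongr; exact tsum_le_l2_mul_l2 hvw g)
        · exact (l2_conv_le _ _).trans (by gcongr; exact tsum_le_l2_mul_l2 hvw f)
    _ = 2 * c * l2 v * (l2 wf * l2 wg) := by ring

end Convolution

/-! ### Trilinear Fourier multipliers -/

section Trilinear

variable {G : Type*}

/-- The symbol of a trilinear Fourier multiplier: a function of the three input frequencies. -/
abbrev Symbol (G : Type*) : Type _ := G → G → G → ℂ

/-- Boundedness of a symbol, the qualitative condition under which the trilinear operator is well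
defined on `ℓ¹` sequences. -/
def IsBoundedSymbol (m : Symbol G) : Prop := ∃ B : ℝ≥0, ∀ ξ η ζ, ‖m ξ η ζ‖ₑ ≤ B

lemma isBoundedSymbol_one : IsBoundedSymbol (1 : Symbol G) := ⟨1, by simp⟩

variable [AddCommGroup G]

/-- The interaction of the frequencies `p.1`, `p.2` and `ξ - p.1 - p.2` in the trilinear
operator. -/
def triTerm (m : Symbol G) (a b c : G → ℂ) (ξ : G) (p : G × G) : ℂ :=
  m p.1 p.2 (ξ - p.1 - p.2) * (a p.1 * b p.2 * c (ξ - p.1 - p.2))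

/-- The trilinear operator with Fourier symbol `m`, acting on sequences of Fourier coefficients. -/
def tri (m : Symbol G) (a b c : G → ℂ) (ξ : G) : ℂ := ∑' p, triTerm m a b c ξ p

lemma tsum_enorm_triTerm_le {m : Symbol G} {B : ℝ≥0∞} {u : G → ℝ≥0∞}
    (hm : ∀ ξ η ζ, ‖m ξ η ζ‖ₑ ≤ B * (u ξ * u η * u ζ)) (a b c : G → ℂ) (ξ : G) :
    ∑' p, ‖triTerm m a b c ξ p‖ₑ
      ≤ B * conv (fun η => u η * ‖a η‖ₑ)
          (conv (fun η => u η * ‖b η‖ₑ) fun η => u η * ‖c η‖ₑ) ξ := by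
  rw [← tsum_prod_eq_conv_conv, ← ENNReal.tsum_mul_left]
  refine ENNReal.tsum_le_tsum fun p => ?_
  simp only [triTerm, enorm_mul]
  calc ‖m p.1 p.2 (ξ - p.1 - p.2)‖ₑ * (‖a p.1‖ₑ * ‖b p.2‖ₑ * ‖c (ξ - p.1 - p.2)‖ₑ)
      ≤ B * (u p.1 * u p.2 * u (ξ - p.1 - p.2)) *
          (‖a p.1‖ₑ * ‖b p.2‖ₑ * ‖c (ξ - p.1 - p.2)‖ₑ) := by gcongr; exact hm _ _ _
    _ = B * (u p.1 * ‖a p.1‖ₑ * (u p.2 * ‖b p.2‖ₑ) *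
          (u (ξ - p.1 - p.2) * ‖c (ξ - p.1 - p.2)‖ₑ)) := by ring

lemma tri_multiplier (k p q r : G → ℂ) (m : Symbol G) (a b c : G → ℂ) :
    tri (fun ξ η ζ => k (ξ + η + ζ) * (p ξ * q η * r ζ) * m ξ η ζ) a b c
      = k * tri m (p * a) (q * b) (r * c) := by
  ext ξ
  rw [Pi.mul_apply, tri, tri, ← tsum_mul_left]
  refine tsum_congr fun x => ?_
  simp only [triTerm, Pi.mul_apply, show x.1 + x.2 + (ξ - x.1 - x.2) = ξ by abel]
  ring

lemma tri_smul_left (k : ℂ) (m : Symbol G) (a b c : G → ℂ) :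
    tri m (k • a) b c = k • tri m a b c := by
  ext ξ
  simp only [tri, triTerm, Pi.smul_apply, smul_eq_mul, ← tsum_mul_left]
  exact tsum_congr fun p => by ring

lemma tri_smul_mid (k : ℂ) (m : Symbol G) (a b c : G → ℂ) :
    tri m a (k • b) c = k • tri m a b c := by
  ext ξ
  simp only [tri, triTerm, Pi.smul_apply, smul_eq_mul, ← tsum_mul_left]
  exact tsum_congr fun p => by ring

lemma tri_smul_right (k : ℂ) (m : Symbol G) (a b c : G → ℂ) :
    tri m a b (k • c) = k • tri m a b c := by
  ext ξ
  simp only [tri, triTerm, Pi.smul_apply, smul_eq_mul, ← tsum_mul_left]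
  exact tsum_congr fun p => by ring

section Summability

variable {m : Symbol G} {a b c : G → ℂ}

lemma tsum_tsum_enorm_triTerm_ne_top (hm : IsBoundedSymbol m)
    (ha : Summable a) (hb : Summable b) (hc : Summable c) :
    ∑' ξ, ∑' p, ‖triTerm m a b c ξ p‖ₑ ≠ ∞ := by
  obtain ⟨B, hB⟩ := hm
  have hB' (ξ η ζ : G) : ‖m ξ η ζ‖ₑ ≤ B * (1 * 1 * 1) := by simpa using hB ξ η ζ
  refine ne_top_of_le_ne_top ?_
    (ENNReal.tsum_le_tsum fun ξ => tsum_enorm_triTerm_le (u := 1) hB' a b c ξ)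
  simp only [ENNReal.tsum_mul_left, tsum_conv, Pi.one_apply, one_mul]
  rw [summable_iff_tsum_enorm_ne_top] at ha hb hc
  finiteness

lemma summable_triTerm (hm : IsBoundedSymbol m)
    (ha : Summable a) (hb : Summable b) (hc : Summable c) (ξ : G) :
    Summable (triTerm m a b c ξ) :=
  summable_iff_tsum_enorm_ne_top.2
    (ENNReal.ne_top_of_tsum_ne_top (tsum_tsum_enorm_triTerm_ne_top hm ha hb hc) ξ)

lemma summable_tri (hm : IsBoundedSymbol m)
    (ha : Summable a) (hb : Summable b) (hc : Summable c) : Summable (tri m a b c) :=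
  summable_iff_tsum_enorm_ne_top.2 <| ne_top_of_le_ne_top
    (tsum_tsum_enorm_triTerm_ne_top hm ha hb hc)
    (ENNReal.tsum_le_tsum fun _ => enorm_tsum_le_tsum_enorm)

lemma tri_add_left (hm : IsBoundedSymbol m) {a' : G → ℂ} (ha : Summable a) (ha' : Summable a')
    (hb : Summable b) (hc : Summable c) :
    tri m (a + a') b c = tri m a b c + tri m a' b c := by
  ext ξ
  rw [Pi.add_apply, tri, tri, tri, ← (summable_triTerm hm ha hb hc ξ).tsum_add
    (summable_triTerm hm ha' hb hc ξ)]
  refine tsum_congr fun p => ?_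
  simp only [triTerm, Pi.add_apply]; ring

lemma tri_add_mid (hm : IsBoundedSymbol m) {b' : G → ℂ} (ha : Summable a) (hb : Summable b)
    (hb' : Summable b') (hc : Summable c) :
    tri m a (b + b') c = tri m a b c + tri m a b' c := by
  ext ξ
  rw [Pi.add_apply, tri, tri, tri, ← (summable_triTerm hm ha hb hc ξ).tsum_add
    (summable_triTerm hm ha hb' hc ξ)]
  refine tsum_congr fun p => ?_
  simp only [triTerm, Pi.add_apply]; ring

lemma tri_add_right (hm : IsBoundedSymbol m) {c' : G → ℂ} (ha : Summable a) (hb : Summable b)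
    (hc : Summable c) (hc' : Summable c') :
    tri m a b (c + c') = tri m a b c + tri m a b c' := by
  ext ξ
  rw [Pi.add_apply, tri, tri, tri, ← (summable_triTerm hm ha hb hc ξ).tsum_add
    (summable_triTerm hm ha hb hc' ξ)]
  refine tsum_congr fun p => ?_
  simp only [triTerm, Pi.add_apply]; ring

lemma tri_sub_symbol {m' : Symbol G} (hm : IsBoundedSymbol m) (hm' : IsBoundedSymbol m')
    (ha : Summable a) (hb : Summable b) (hc : Summable c) :
    tri (m - m') a b c = tri m a b c - tri m' a b c := by
  ext ξ
  rw [Pi.sub_apply, tri, tri, tri, ← (summable_triTerm hm ha hb hc ξ).tsum_sub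
    (summable_triTerm hm' ha hb hc ξ)]
  refine tsum_congr fun p => ?_
  simp only [triTerm, Pi.sub_apply]; ring

end Summability

end Trilinear

/-! ### Sobolev norms of sequences of Fourier coefficients -/

section Weight

variable {d : ℕ}

/-- The lattice `ℤ^d` of frequencies. -/
abbrev Freq (d : ℕ) : Type := Fin d → ℤ

lemma freqSq_nonneg (ξ : Freq d) : 0 ≤ freqSq ξ := Finset.sum_nonneg fun _ _ => sq_nonneg _

lemma freqSq_neg (ξ : Freq d) : freqSq (-ξ) = freqSq ξ := by simp [freqSq]

lemma one_add_freqSq_pos (ξ : Freq d) : 0 < 1 + freqSq ξ := by linarith [freqSq_nonneg ξ]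

lemma freqSq_add_le (ξ η : Freq d) : freqSq (ξ + η) ≤ 2 * freqSq ξ + 2 * freqSq η := by
  simp only [freqSq, Finset.mul_sum, ← Finset.sum_add_distrib]
  refine Finset.sum_le_sum fun j _ => ?_
  push_cast [Pi.add_apply]
  nlinarith [sq_nonneg ((ξ j : ℝ) - η j)]

lemma norm_sq_le_freqSq (ξ : Freq d) : ‖ξ‖ ^ 2 ≤ freqSq ξ := by
  refine (Real.le_sqrt (norm_nonneg _) (freqSq_nonneg ξ)).mp ?_
  refine (pi_norm_le_iff_of_nonneg (Real.sqrt_nonneg _)).2 fun j => Real.le_sqrt_of_sq_le ?_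
  rw [Int.norm_eq_abs, sq_abs]
  exact Finset.single_le_sum (f := fun j => (ξ j : ℝ) ^ 2) (fun _ _ => sq_nonneg _)
    (Finset.mem_univ j)

lemma summable_norm_rpow_freq {r : ℝ} (hr : r < -d) : Summable fun ξ : Freq d => ‖ξ‖ ^ r := by
  let b := Pi.basisFun ℝ (Fin d)
  let L : Submodule ℤ (Fin d → ℝ) := Submodule.span ℤ (Set.range b)
  have hmem (ξ : Freq d) : (fun j => (ξ j : ℝ)) ∈ L := by
    rw [b.mem_span_iff_repr_mem ℤ]
    exact fun i => ⟨ξ i, by simp [b]⟩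
  have hrank : Module.finrank ℤ L = d := by rw [ZLattice.rank ℝ L]; simp
  have hinj : Function.Injective fun ξ : Freq d => (⟨fun j => (ξ j : ℝ), hmem ξ⟩ : L) :=
    fun ξ η h => funext fun j => Int.cast_injective (congrFun (congrArg Subtype.val h) j)
  have hnorm (ξ : Freq d) : ‖(⟨fun j => (ξ j : ℝ), hmem ξ⟩ : L)‖ = ‖ξ‖ := by
    simp [Pi.norm_def, nnnorm, Int.norm_eq_abs]
  simpa only [Function.comp_def, hnorm] using
    (ZLattice.summable_norm_rpow L r (by rwa [hrank])).comp_injective hinj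

lemma summable_one_add_freqSq_rpow {γ : ℝ} (hγ : (d : ℝ) / 2 < γ) :
    Summable fun ξ : Freq d => (1 + freqSq ξ) ^ (-γ) := by
  have hγ0 : 0 < γ := lt_of_le_of_lt (by positivity) hγ
  refine Summable.of_norm_bounded_eventually
    (summable_norm_rpow_freq (d := d) (r := 2 * -γ) (by linarith)) ?_
  filter_upwards [(Set.finite_singleton (0 : Freq d)).compl_mem_cofinite] with ξ hξ
  have hpos : 0 < ‖ξ‖ := norm_pos_iff.2 hξ
  have := one_add_freqSq_pos ξ
  rw [Real.norm_of_nonneg (by positivity), Real.rpow_mul hpos.le, Real.rpow_two]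
  exact Real.rpow_le_rpow_of_nonpos (by positivity) (by linarith [norm_sq_le_freqSq ξ])
    (by linarith)

/-- The weight `(1 + |ξ|²)^{s/2}` of `H^s`. -/
def wt (s : ℝ) (ξ : Freq d) : ℝ≥0∞ := ENNReal.ofReal ((1 + freqSq ξ) ^ (s / 2))

lemma wt_neg (s : ℝ) (ξ : Freq d) : wt s (-ξ) = wt s ξ := by rw [wt, wt, freqSq_neg]

lemma wt_zero (ξ : Freq d) : wt 0 ξ = 1 := by simp [wt]

lemma wt_two (ξ : Freq d) : wt 2 ξ = ENNReal.ofReal (1 + freqSq ξ) := by simp [wt]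

lemma wt_add_exponent (s t : ℝ) (ξ : Freq d) : wt (s + t) ξ = wt s ξ * wt t ξ := by
  have := one_add_freqSq_pos ξ
  rw [wt, wt, wt, ← ENNReal.ofReal_mul (by positivity), ← Real.rpow_add this, add_div]

lemma wt_sq (s : ℝ) (ξ : Freq d) : wt s ξ ^ 2 = ENNReal.ofReal ((1 + freqSq ξ) ^ s) := by
  rw [sq, ← wt_add_exponent, wt, add_self_div_two]

lemma wt_neg_exponent_mul (s : ℝ) (ξ : Freq d) : wt (-s) ξ * wt s ξ = 1 := by
  rw [← wt_add_exponent, neg_add_cancel, wt_zero]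

lemma wt_mono {s t : ℝ} (h : s ≤ t) (ξ : Freq d) : wt s ξ ≤ wt t ξ :=
  ENNReal.ofReal_le_ofReal <| Real.rpow_le_rpow_of_exponent_le
    (by linarith [freqSq_nonneg ξ]) (by linarith)

lemma wt_add_le {s : ℝ} (hs : 0 ≤ s) (ξ η : Freq d) :
    wt s (ξ + η) ≤ ENNReal.ofReal (4 ^ (s / 2)) * (wt s ξ + wt s η) := by
  set x := 1 + freqSq ξ
  set y := 1 + freqSq η
  have hx : 0 < x := one_add_freqSq_pos ξ
  have hy : 0 < y := one_add_freqSq_pos η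
  have hxy := one_add_freqSq_pos (ξ + η)
  rw [wt, wt, wt, ← ENNReal.ofReal_add (by positivity) (by positivity),
    ← ENNReal.ofReal_mul (by positivity)]
  refine ENNReal.ofReal_le_ofReal ?_
  calc (1 + freqSq (ξ + η)) ^ (s / 2)
      ≤ (4 * max x y) ^ (s / 2) := by
        gcongr
        linarith [freqSq_add_le ξ η, le_max_left x y, le_max_right x y]
    _ = 4 ^ (s / 2) * max (x ^ (s / 2)) (y ^ (s / 2)) := by
        rw [Real.mul_rpow (by norm_num) (by positivity),
          (Real.monotoneOn_rpow_Ici_of_exponent_nonneg (by positivity)).map_max hx.le hy.le]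
    _ ≤ 4 ^ (s / 2) * (x ^ (s / 2) + y ^ (s / 2)) := by
        gcongr
        exact max_le_add_of_nonneg (by positivity) (by positivity)

lemma l2_wt_neg_ne_top {γ : ℝ} (hγ : (d : ℝ) / 2 < γ) :
    l2 (fun ξ : Freq d => wt (-γ) ξ) ≠ ∞ := by
  simp only [l2, wt_sq]
  exact ENNReal.rpow_ne_top_of_nonneg (by norm_num)
    (summable_one_add_freqSq_rpow hγ).tsum_ofReal_ne_top

end Weight

section SeqNorm

variable {d : ℕ}

/-- The Sobolev norm `(∑ (1 + |ξ|²)^s |a ξ|²)^{1/2}` of a sequence of Fourier coefficients. -/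
def seqNorm (s : ℝ) (a : Freq d → ℂ) : ℝ≥0∞ := l2 fun ξ => wt s ξ * ‖a ξ‖ₑ

lemma seqNorm_congr {s : ℝ} {a b : Freq d → ℂ} (h : ∀ ξ, ‖a ξ‖ₑ = ‖b ξ‖ₑ) :
    seqNorm s a = seqNorm s b := by simp only [seqNorm, h]

lemma seqNorm_mono_exponent {s t : ℝ} (h : s ≤ t) (a : Freq d → ℂ) :
    seqNorm s a ≤ seqNorm t a := l2_mono fun ξ => by gcongr; exact wt_mono h ξ

lemma seqNorm_zero (s : ℝ) : seqNorm s (0 : Freq d → ℂ) = 0 := by simp [seqNorm, l2]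

lemma seqNorm_add_le (s : ℝ) (a b : Freq d → ℂ) :
    seqNorm s (a + b) ≤ seqNorm s a + seqNorm s b := by
  refine (l2_mono fun ξ => ?_).trans (l2_add_le _ _)
  rw [← mul_add]
  gcongr
  exact enorm_add_le _ _

lemma seqNorm_neg (s : ℝ) (a : Freq d → ℂ) : seqNorm s (-a) = seqNorm s a :=
  seqNorm_congr fun ξ => by simp

lemma seqNorm_sub_le (s : ℝ) (a b : Freq d → ℂ) :
    seqNorm s (a - b) ≤ seqNorm s a + seqNorm s b := by
  rw [sub_eq_add_neg, ← seqNorm_neg s b]; exact seqNorm_add_le s a (-b)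

lemma seqNorm_smul (s : ℝ) (c : ℂ) (a : Freq d → ℂ) :
    seqNorm s (c • a) = ‖c‖ₑ * seqNorm s a := by
  rw [seqNorm, seqNorm, ← l2_const_mul]
  simp only [Pi.smul_apply, enorm_smul, mul_left_comm]

lemma summable_of_seqNorm_ne_top {γ : ℝ} (hγ : (d : ℝ) / 2 < γ) {a : Freq d → ℂ}
    (h : seqNorm γ a ≠ ∞) : Summable a :=
  summable_iff_tsum_enorm_ne_top.2 <| ne_top_of_le_ne_top
    (ENNReal.mul_ne_top (l2_wt_neg_ne_top hγ) h)
    (tsum_le_l2_mul_l2 (wt_neg_exponent_mul γ) fun ξ => ‖a ξ‖ₑ)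

/-- A symbol of order `σ` in each of the three frequencies, with constant `B`. -/
def SymbolBound (σ : ℝ) (B : ℝ≥0) (m : Symbol (Freq d)) : Prop :=
  ∀ ξ η ζ, ‖m ξ η ζ‖ₑ ≤ B * (wt σ ξ * wt σ η * wt σ ζ)

lemma symbolBound_zero {B : ℝ≥0} {m : Symbol (Freq d)} :
    SymbolBound 0 B m ↔ ∀ ξ η ζ, ‖m ξ η ζ‖₊ ≤ B := by
  simp [SymbolBound, wt_zero, enorm_eq_nnnorm]

lemma SymbolBound.isBoundedSymbol {B : ℝ≥0} {m : Symbol (Freq d)} (hm : SymbolBound 0 B m) :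
    IsBoundedSymbol m := ⟨B, by simpa [SymbolBound, wt_zero] using hm⟩

variable (d) in
/-- The square of the constant in `‖f g‖_{H^γ} ≤ C ‖f‖_{H^γ} ‖g‖_{H^γ}`; the junk value of
`toNNReal` at `∞` does not occur for `γ > d/2`. -/
def triConst (γ : ℝ) : ℝ≥0 :=
  (2 * ENNReal.ofReal (4 ^ (γ / 2)) * l2 fun ξ : Freq d => wt (-γ) ξ).toNNReal ^ 2

lemma seqNorm_tri_le {γ : ℝ} (hγ : (d : ℝ) / 2 < γ) {σ : ℝ} {B : ℝ≥0} {m : Symbol (Freq d)}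
    (hm : SymbolBound σ B m) (a b c : Freq d → ℂ) :
    seqNorm γ (tri m a b c)
      ≤ triConst d γ * B * (seqNorm (γ + σ) a * seqNorm (γ + σ) b * seqNorm (γ + σ) c) := by
  have hγ0 : 0 ≤ γ := le_trans (by positivity) hγ.le
  set K := 2 * ENNReal.ofReal (4 ^ (γ / 2)) * l2 fun ξ : Freq d => wt (-γ) ξ with hK
  have hKtop : K ≠ ∞ := ENNReal.mul_ne_top (by finiteness) (l2_wt_neg_ne_top hγ)
  have algebra (f g : Freq d → ℝ≥0∞) : l2 (fun ξ => wt γ ξ * conv f g ξ)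
      ≤ K * (l2 (fun ξ => wt γ ξ * f ξ) * l2 fun ξ => wt γ ξ * g ξ) :=
    l2_mul_conv_le (wt_add_le hγ0) (wt_neg_exponent_mul γ) f g
  have hnorm (a : Freq d → ℂ) :
      seqNorm (γ + σ) a = l2 fun ξ => wt γ ξ * (wt σ ξ * ‖a ξ‖ₑ) := by
    simp only [seqNorm, wt_add_exponent, mul_assoc]
  calc seqNorm γ (tri m a b c)
      ≤ B * l2 (fun ξ => wt γ ξ * conv (fun η => wt σ η * ‖a η‖ₑ)
          (conv (fun η => wt σ η * ‖b η‖ₑ) fun η => wt σ η * ‖c η‖ₑ) ξ) := by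
        rw [← l2_const_mul]
        refine l2_mono fun ξ => ?_
        rw [mul_left_comm]
        gcongr
        exact enorm_tsum_le_tsum_enorm.trans (tsum_enorm_triTerm_le hm a b c ξ)
    _ ≤ B * (K * (seqNorm (γ + σ) a * (K * (seqNorm (γ + σ) b * seqNorm (γ + σ) c)))) := by
        simp only [hnorm]
        gcongr
        refine (algebra _ _).trans ?_
        gcongr
        exact algebra _ _
    _ = triConst d γ * B * (seqNorm (γ + σ) a * seqNorm (γ + σ) b * seqNorm (γ + σ) c) := by
        rw [triConst, ← hK, ENNReal.coe_pow, ENNReal.coe_toNNReal hKtop]; ring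

/-- The Fourier coefficients of the complex conjugate. -/
def cstar (a : Freq d → ℂ) (ξ : Freq d) : ℂ := conj (a (-ξ))

lemma cstar_add (a b : Freq d → ℂ) : cstar (a + b) = cstar a + cstar b := by
  ext ξ; simp [cstar]

lemma cstar_sub (a b : Freq d → ℂ) : cstar (a - b) = cstar a - cstar b := by
  ext ξ; simp [cstar]

lemma seqNorm_cstar (s : ℝ) (a : Freq d → ℂ) : seqNorm s (cstar a) = seqNorm s a := by
  rw [seqNorm, seqNorm, ← l2_comp_equiv (Equiv.neg (Freq d))]
  simp [cstar, wt_neg, enorm_eq_nnnorm]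

lemma summable_cstar {a : Freq d → ℂ} (ha : Summable a) : Summable (cstar a) :=
  (ha.comp_injective neg_injective).star

end SeqNorm

/-! ### Fourier series on the torus -/

section FourierSeries

variable {d : ℕ}

lemma mode_add (ξ η : Freq d) (x : Torus d) : mode (ξ + η) x = mode ξ x * mode η x := by
  simp only [mode, Pi.add_apply, fourier_add, ← Finset.prod_mul_distrib]

lemma mode_neg (ξ : Freq d) (x : Torus d) : mode (-ξ) x = conj (mode ξ x) := by
  simp only [mode, Pi.neg_apply, fourier_neg, map_prod]

lemma norm_mode (ξ : Freq d) (x : Torus d) : ‖mode ξ x‖ = 1 := by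
  simp only [mode, fourier_apply, norm_prod, Circle.norm_coe, Finset.prod_const_one]

/-- The Fourier mode as a continuous function. -/
def modeC (ξ : Freq d) : C(Torus d, ℂ) where
  toFun := mode ξ
  continuous_toFun := by unfold mode; fun_prop

lemma norm_modeC_le (ξ : Freq d) : ‖modeC ξ‖ ≤ 1 :=
  (ContinuousMap.norm_le _ zero_le_one).mpr fun x => (norm_mode ξ x).le

/-- The Fourier mode as an element of `L²`. -/
def modeLp (ξ : Freq d) : L2 d := ContinuousMap.toLp (E := ℂ) 2 volume ℂ (modeC ξ)

lemma coeFn_modeLp (ξ : Freq d) : modeLp ξ =ᵐ[volume] mode ξ :=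
  ContinuousMap.coeFn_toLp volume (modeC ξ)

variable (d) in
/-- The rescaling of the torus `(ℝ / 2πℤ)^d` to Mathlib's torus `(ℝ / ℤ)^d`. -/
def toUnitAddTorus : Torus d ≃ₜ UnitAddTorus (Fin d) :=
  .piCongrRight fun _ => AddCircle.homeomorphAddCircle _ _ Real.two_pi_pos.ne' one_ne_zero

lemma mFourier_toUnitAddTorus (ξ : Freq d) (x : Torus d) :
    UnitAddTorus.mFourier ξ (toUnitAddTorus d x) = mode ξ x := by
  change ∏ j, fourier (ξ j) (toUnitAddTorus d x j) = ∏ j, fourier (ξ j) (x j)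
  refine Finset.prod_congr rfl fun j _ => ?_
  change fourier (ξ j) (AddCircle.homeomorphAddCircle _ _ _ _ (x j)) = _
  induction x j using QuotientAddGroup.induction_on with | _ y
  rw [AddCircle.homeomorphAddCircle_apply_mk, fourier_coe_apply, fourier_coe_apply]
  push_cast
  congr 1
  field_simp

variable (d) in
/-- The embedding of the continuous functions on `(ℝ / ℤ)^d` into `L²` of `(ℝ / 2πℤ)^d`. -/
def rescaleLp : C(UnitAddTorus (Fin d), ℂ) →L[ℂ] L2 d :=
  (ContinuousMap.toLp (E := ℂ) 2 volume ℂ).comp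
    ⟨(ContinuousMap.compRightAlgHom ℂ ℂ (toUnitAddTorus d : C(_, _))).toLinearMap,
      ContinuousMap.continuous_precomp _⟩

lemma rescaleLp_mFourier (ξ : Freq d) : rescaleLp d (UnitAddTorus.mFourier ξ) = modeLp ξ := by
  have h : (UnitAddTorus.mFourier ξ).comp (toUnitAddTorus d : C(_, _)) = modeC ξ :=
    ContinuousMap.ext (mFourier_toUnitAddTorus ξ)
  rw [modeLp, ← h]
  rfl

lemma denseRange_rescaleLp : DenseRange (rescaleLp d) := by
  have hsurj : Function.Surjective
      fun f : C(UnitAddTorus (Fin d), ℂ) => f.comp (toUnitAddTorus d : C(_, _)) := fun f =>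
    ⟨f.comp ((toUnitAddTorus d).symm : C(_, _)),
      ContinuousMap.ext fun x => congrArg f ((toUnitAddTorus d).left_inv x)⟩
  exact (ContinuousMap.toLp_denseRange ℂ (volume : Measure (Torus d)) ℂ
    (by norm_num)).comp hsurj.denseRange (ContinuousLinearMap.continuous _)

lemma span_modeLp_closure :
    (Submodule.span ℂ (Set.range (modeLp (d := d)))).topologicalClosure = ⊤ := by
  have h := denseRange_rescaleLp.topologicalClosure_map_submodule
    (UnitAddTorus.span_mFourier_closure_eq_top (d := Fin d))
  rwa [Submodule.map_span, ← Set.range_comp, show ⇑(rescaleLp d).toLinearMap ∘ _ = modeLp from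
    funext rescaleLp_mFourier] at h

/-- The volume `(2π)^d` of the torus. -/
def torusVol (d : ℕ) : ℝ := (2 * Real.pi) ^ d

lemma torusVol_pos : 0 < torusVol d := pow_pos Real.two_pi_pos d

lemma torusVol_ne_zero : (torusVol d : ℂ) ≠ 0 := Complex.ofReal_ne_zero.2 torusVol_pos.ne'

lemma integral_fourier (n : ℤ) :
    ∫ x : AddCircle (2 * Real.pi), fourier n x = if n = 0 then ((2 * Real.pi : ℝ) : ℂ) else 0 := by
  have h := orthonormal_iff_ite.mp (orthonormal_fourier (T := 2 * Real.pi)) 0 n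
  simp only [ContinuousMap.inner_toLp, fourier_zero, map_one, mul_one, eq_comm (a := (0 : ℤ))] at h
  rw [AddCircle.volume_eq_smul_haarAddCircle, integral_smul_measure, h,
    ENNReal.toReal_ofReal Real.two_pi_pos.le]
  simp

lemma integral_mode (ξ : Freq d) :
    ∫ x : Torus d, mode ξ x = if ξ = 0 then ↑(torusVol d) else 0 := by
  unfold mode
  rw [integral_fintype_prod_volume_eq_prod (fun j (x : AddCircle (2 * Real.pi)) => fourier (ξ j) x)]
  simp only [integral_fourier]
  split_ifs with h
  · simp [h, torusVol]
  · obtain ⟨i, hi⟩ := Function.ne_iff.mp h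
    exact Finset.prod_eq_zero (Finset.mem_univ i) (if_neg hi)

lemma inner_modeLp (ξ η : Freq d) :
    inner ℂ (modeLp ξ) (modeLp η) = if η = ξ then (torusVol d : ℂ) else 0 := by
  have h (x : Torus d) : modeC η x * conj (modeC ξ x) = mode (η - ξ) x := by
    rw [sub_eq_add_neg, mode_add, mode_neg]; rfl
  simp only [modeLp, ContinuousMap.inner_toLp, h, integral_mode, sub_eq_zero]

/-- The Fourier coefficient as a continuous linear functional on `L²`. -/
def coeffL (ξ : Freq d) : L2 d →L[ℂ] ℂ := (torusVol d : ℂ)⁻¹ • innerSL ℂ (modeLp ξ)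

lemma coeff_eq_coeffL (f : L2 d) (ξ : Freq d) : coeff f ξ = coeffL ξ f := by
  change _ = (torusVol d : ℂ)⁻¹ * inner ℂ (modeLp ξ) f
  rw [coeff, torusVol, L2.inner_def, Complex.ofReal_pow, inv_pow]
  congr 1
  refine integral_congr_ae ?_
  filter_upwards [coeFn_modeLp ξ] with x hx
  rw [hx, RCLike.inner_apply, mul_comm]

lemma coeffL_modeLp (ξ η : Freq d) : coeffL ξ (modeLp η) = if η = ξ then 1 else 0 := by
  change (torusVol d : ℂ)⁻¹ * inner ℂ (modeLp ξ) (modeLp η) = _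
  rw [inner_modeLp, mul_ite, inv_mul_cancel₀ torusVol_ne_zero, mul_zero]

lemma coeff_add (f g : L2 d) : coeff (f + g : L2 d) = coeff f + coeff g := by
  ext ξ; simp only [Pi.add_apply, coeff_eq_coeffL, map_add]

lemma coeff_sub (f g : L2 d) : coeff (f - g : L2 d) = coeff f - coeff g := by
  ext ξ; simp only [Pi.sub_apply, coeff_eq_coeffL, map_sub]

lemma coeff_smul (k : ℂ) (f : L2 d) : coeff (k • f : L2 d) = k • coeff f := by
  ext ξ; simp only [Pi.smul_apply, coeff_eq_coeffL, map_smul]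

lemma continuous_coeff (ξ : Freq d) : Continuous fun f : L2 d => coeff f ξ := by
  simpa only [coeff_eq_coeffL] using (coeffL ξ).continuous

lemma coeff_congr {f g : Torus d → ℂ} (h : f =ᵐ[volume] g) : coeff f = coeff g := by
  ext ξ
  refine congrArg _ (integral_congr_ae ?_)
  filter_upwards [h] with x hx
  rw [hx]

variable (d) in
/-- The norm `(2π)^{d/2}` of the Fourier modes in `L²`, as a complex number. -/
def modeNorm : ℂ := (√(torusVol d) : ℝ)

lemma modeNorm_ne_zero : modeNorm d ≠ 0 :=
  Complex.ofReal_ne_zero.2 (Real.sqrt_pos.2 torusVol_pos).ne'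

lemma conj_modeNorm : conj (modeNorm d) = modeNorm d := Complex.conj_ofReal _

lemma modeNorm_mul_self : modeNorm d * modeNorm d = torusVol d := by
  rw [modeNorm, ← Complex.ofReal_mul, Real.mul_self_sqrt torusVol_pos.le]

lemma orthonormal_smul_modeLp : Orthonormal ℂ fun ξ : Freq d => (modeNorm d)⁻¹ • modeLp ξ := by
  rw [orthonormal_iff_ite]
  intro ξ η
  rw [inner_smul_left, inner_smul_right, inner_modeLp, map_inv₀, conj_modeNorm, ← mul_assoc,
    ← mul_inv, modeNorm_mul_self, mul_ite, inv_mul_cancel₀ torusVol_ne_zero, mul_zero]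
  simp only [eq_comm]

variable (d) in
/-- The Hilbert basis of normalised Fourier modes. -/
def modeBasis : HilbertBasis (Freq d) ℂ (L2 d) :=
  HilbertBasis.mk orthonormal_smul_modeLp <| by
    rw [← span_modeLp_closure]
    refine Submodule.topologicalClosure_mono (Submodule.span_le.2 ?_)
    rintro _ ⟨ξ, rfl⟩
    rw [← smul_inv_smul₀ modeNorm_ne_zero (modeLp ξ)]
    exact Submodule.smul_mem _ _ (Submodule.subset_span ⟨ξ, rfl⟩)

lemma modeBasis_repr (f : L2 d) (ξ : Freq d) :
    (modeBasis d).repr f ξ = modeNorm d * coeff f ξ := by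
  rw [HilbertBasis.repr_apply_apply, modeBasis, HilbertBasis.coe_mk, inner_smul_left, map_inv₀,
    conj_modeNorm, coeff_eq_coeffL]
  change _ = modeNorm d * ((torusVol d : ℂ)⁻¹ * inner ℂ (modeLp ξ) f)
  rw [← modeNorm_mul_self]
  field_simp [modeNorm_ne_zero]

lemma coeff_injective : Function.Injective fun f : L2 d => coeff f := by
  intro f g h
  refine (modeBasis d).repr.injective (lp.ext (funext fun ξ => ?_))
  rw [modeBasis_repr, modeBasis_repr, show coeff f = coeff g from h]

lemma memℓp_coeff (f : L2 d) : Memℓp (coeff f) 2 := by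
  have h : coeff f = (modeNorm d)⁻¹ • ⇑((modeBasis d).repr f) := by
    ext ξ
    rw [Pi.smul_apply, modeBasis_repr, smul_eq_mul, inv_mul_cancel_left₀ modeNorm_ne_zero]
  rw [h]
  exact (lp.memℓp _).const_smul _

lemma exists_coeff_eq {c : Freq d → ℂ} (hc : Memℓp c 2) : ∃ f : L2 d, coeff f = c := by
  refine ⟨(modeBasis d).repr.symm ⟨_, hc.const_smul (modeNorm d)⟩, funext fun ξ => ?_⟩
  refine mul_left_cancel₀ (modeNorm_ne_zero (d := d)) ?_
  rw [← modeBasis_repr, LinearIsometryEquiv.apply_symm_apply]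
  rfl

lemma coeff_funLaplacian {F : ℂ → ℂ} {B : ℝ} (hF : ∀ x : ℝ, ‖F (-(x : ℂ))‖ ≤ B) (f : L2 d) :
    coeff (funLaplacian F f) = (fun ξ => F (-(freqSq ξ : ℂ))) * coeff f := by
  have h : ∃ g : L2 d, ∀ ξ, coeff g ξ = F (-(freqSq ξ : ℂ)) * coeff f ξ := by
    simp only [← funext_iff]
    refine exists_coeff_eq (((memℓp_coeff f).norm.const_smul B).mono fun ξ => ?_)
    exact (norm_mul _ _).trans_le (mul_le_mul_of_nonneg_right (hF (freqSq ξ)) (norm_nonneg _))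
  rw [funLaplacian, dif_pos h]
  exact funext h.choose_spec

end FourierSeries

/-! ### Absolutely convergent Fourier series -/

section HasFourier

variable {d : ℕ} {a b c : Freq d → ℂ}

/-- The sum of an absolutely convergent Fourier series. -/
def fourierSum (a : Freq d → ℂ) : C(Torus d, ℂ) := ∑' ξ, a ξ • modeC ξ

lemma summable_smul_modeC (ha : Summable a) : Summable fun ξ => a ξ • modeC ξ := by
  refine Summable.of_norm_bounded ha.norm fun ξ => ?_
  rw [norm_smul]
  exact mul_le_of_le_one_right (norm_nonneg _) (norm_modeC_le ξ)

lemma fourierSum_apply (ha : Summable a) (x : Torus d) :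
    fourierSum a x = ∑' ξ, a ξ * mode ξ x :=
  (ContinuousMap.hasSum_apply (summable_smul_modeC ha).hasSum x).tsum_eq.symm

lemma summable_norm_mul_mode (ha : Summable a) (x : Torus d) :
    Summable fun ξ => ‖a ξ * mode ξ x‖ := by
  simpa only [norm_mul, norm_mode, mul_one] using ha.norm

lemma coeff_fourierSum (ha : Summable a) : coeff (fourierSum a) = a := by
  ext ξ
  rw [← coeff_congr (ContinuousMap.coeFn_toLp (p := 2) (𝕜 := ℂ) volume (fourierSum a)),
    coeff_eq_coeffL, fourierSum, ContinuousLinearMap.map_tsum _ (summable_smul_modeC ha),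
    ContinuousLinearMap.map_tsum]
  · simp only [map_smul]
    change ∑' η, a η * coeffL ξ (modeLp η) = _
    simp [coeffL_modeLp]
  · exact (summable_smul_modeC ha).mapL _

/-- `f` is almost everywhere the sum of the absolutely convergent Fourier series with
coefficients `a`. -/
structure HasFourier (f : Torus d → ℂ) (a : Freq d → ℂ) : Prop where
  summable : Summable a
  ae_eq : f =ᵐ[volume] fourierSum a

namespace HasFourier

variable {f g h : Torus d → ℂ}

lemma of_fourierSum (ha : Summable a) : HasFourier (fourierSum a) a :=
  ⟨ha, Filter.EventuallyEq.rfl⟩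

lemma coeff_eq (hf : HasFourier f a) : coeff f = a := by
  rw [coeff_congr hf.ae_eq, coeff_fourierSum hf.summable]

lemma coeff_toL2 (hf : HasFourier f a) : coeff (toL2 f) = a := by
  have hmem : MemLp f 2 (volume : Measure (Torus d)) :=
    (Lp.memLp (ContinuousMap.toLp 2 volume ℂ (fourierSum a))).ae_eq
      ((ContinuousMap.coeFn_toLp volume _).trans hf.ae_eq.symm)
  rw [toL2, dif_pos hmem, coeff_congr hmem.coeFn_toLp, hf.coeff_eq]

lemma of_summable_coeff {f : L2 d} (hf : Summable (coeff f)) : HasFourier f (coeff f) := by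
  have hsum := ContinuousMap.coeFn_toLp (p := 2) (𝕜 := ℂ) volume (fourierSum (coeff f))
  have hf' : ContinuousMap.toLp (E := ℂ) 2 volume ℂ (fourierSum (coeff f)) = f :=
    coeff_injective ((coeff_congr hsum).trans (coeff_fourierSum hf))
  rw [hf'] at hsum
  exact ⟨hf, hsum⟩

lemma congr (hf : HasFourier f a) (h : f =ᵐ[volume] g) : HasFourier g a :=
  ⟨hf.summable, h.symm.trans hf.ae_eq⟩

lemma unique (hf : HasFourier f a) (hf' : HasFourier f b) : a = b :=
  hf.coeff_eq.symm.trans hf'.coeff_eq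

lemma conjugate (hf : HasFourier f a) : HasFourier (fun x => conj (f x)) (cstar a) := by
  refine ⟨summable_cstar hf.summable, ?_⟩
  filter_upwards [hf.ae_eq] with x hx
  rw [hx, fourierSum_apply hf.summable, fourierSum_apply (summable_cstar hf.summable),
    Complex.conj_tsum, ← (Equiv.neg (Freq d)).tsum_eq]
  simp [cstar, mode_neg]

end HasFourier

/-- A pair of frequencies together with the sum of all three, in place of the third frequency. -/
def sumFreqEquiv (d : ℕ) : Freq d × (Freq d × Freq d) ≃ (Freq d × Freq d) × Freq d where
  toFun q := (q.2, q.1 - q.2.1 - q.2.2)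
  invFun q := (q.2 + q.1.2 + q.1.1, q.1)
  left_inv q := by simp
  right_inv q := by
    ext1
    · simp
    · simp only; abel

lemma fourierSum_mul_fourierSum_mul_fourierSum (ha : Summable a) (hb : Summable b)
    (hc : Summable c) :
    fourierSum a * fourierSum b * fourierSum c = fourierSum (tri 1 a b c) := by
  ext x
  have sa := summable_norm_mul_mode ha x
  have sb := summable_norm_mul_mode hb x
  have sc := summable_norm_mul_mode hc x
  have sabc := ((sa.mul_norm sb).mul_norm sc).of_norm
  rw [ContinuousMap.mul_apply, ContinuousMap.mul_apply, fourierSum_apply ha, fourierSum_apply hb,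
    fourierSum_apply hc, fourierSum_apply (summable_tri isBoundedSymbol_one ha hb hc),
    tsum_mul_tsum_of_summable_norm sa sb, tsum_mul_tsum_of_summable_norm (sa.mul_norm sb) sc,
    ← (sumFreqEquiv d).tsum_eq]
  refine (((sumFreqEquiv d).summable_iff.mpr sabc).tsum_prod).trans (tsum_congr fun ξ => ?_)
  rw [tri, ← tsum_mul_right]
  refine tsum_congr fun p => ?_
  have hξ : mode ξ x = mode p.1 x * mode p.2 x * mode (ξ - p.1 - p.2) x := by
    rw [← mode_add, ← mode_add]; congr 1; abel
  simp only [triTerm, Function.comp_apply, sumFreqEquiv, Equiv.coe_fn_mk, Pi.one_apply, hξ]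
  ring

lemma HasFourier.mul_mul {f g h : Torus d → ℂ} (hf : HasFourier f a) (hg : HasFourier g b)
    (hh : HasFourier h c) : HasFourier (fun x => f x * g x * h x) (tri 1 a b c) := by
  refine ⟨summable_tri isBoundedSymbol_one hf.summable hg.summable hh.summable, ?_⟩
  filter_upwards [hf.ae_eq, hg.ae_eq, hh.ae_eq] with x h1 h2 h3
  rw [h1, h2, h3, ← fourierSum_mul_fourierSum_mul_fourierSum hf.summable hg.summable hh.summable]
  rfl

end HasFourier

/-! ### Regularity in time -/

section Regularity

variable {d : ℕ}

/-- The Fourier coefficients with frequency in `S`, weighted so that their Euclidean norm is the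
corresponding part of `seqNorm s`. -/
def weightedRestrict (s : ℝ) (S : Finset (Freq d)) (a : Freq d → ℂ) : EuclideanSpace ℂ S :=
  WithLp.toLp 2 fun ξ => ((1 + freqSq ξ.1) ^ (s / 2) : ℝ) * a ξ

lemma weightedRestrict_sub (s : ℝ) (S : Finset (Freq d)) (a b : Freq d → ℂ) :
    weightedRestrict s S (a - b) = weightedRestrict s S a - weightedRestrict s S b := by
  ext ξ; simp [weightedRestrict, mul_sub]

lemma continuous_weightedRestrict (s : ℝ) (S : Finset (Freq d)) :
    Continuous (weightedRestrict s S) := by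
  unfold weightedRestrict; fun_prop

lemma hasDerivAt_weightedRestrict (s : ℝ) (S : Finset (Freq d)) {a : ℝ → Freq d → ℂ}
    {a' : Freq d → ℂ} {t : ℝ} (ha : ∀ ξ, HasDerivAt (fun t => a t ξ) (a' ξ) t) :
    HasDerivAt (fun t => weightedRestrict s S (a t)) (weightedRestrict s S a') t :=
  (PiLp.continuousLinearEquiv 2 ℝ fun _ : S => ℂ).symm.hasFDerivAt.comp_hasDerivAt t
    (hasDerivAt_pi.2 fun ξ : S => (ha ξ).const_mul _)

lemma enorm_weightedRestrict_sq (s : ℝ) (S : Finset (Freq d)) (a : Freq d → ℂ) :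
    ‖weightedRestrict s S a‖ₑ ^ 2 = ∑ ξ ∈ S, (wt s ξ * ‖a ξ‖ₑ) ^ 2 := by
  have hwt (ξ : Freq d) : ‖((1 + freqSq ξ) ^ (s / 2) : ℝ) * a ξ‖ₑ = wt s ξ * ‖a ξ‖ₑ := by
    rw [enorm_mul, ← ofReal_norm, Complex.norm_of_nonneg
      (Real.rpow_nonneg (one_add_freqSq_pos ξ).le _), wt]
  rw [enorm_eq_nnnorm, ← ENNReal.coe_pow, EuclideanSpace.nnnorm_eq, NNReal.sq_sqrt,
    ENNReal.ofNNReal_finsetSum, ← Finset.sum_coe_sort S]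
  simp only [weightedRestrict, ENNReal.coe_pow, ← enorm_eq_nnnorm, hwt]

lemma seqNorm_le_iff {s : ℝ} {a : Freq d → ℂ} {C : ℝ≥0∞} :
    seqNorm s a ≤ C ↔ ∀ S, ‖weightedRestrict s S a‖ₑ ≤ C := by
  have hsq {x y : ℝ≥0∞} : x ≤ y ↔ x ^ 2 ≤ y ^ 2 :=
    (ENNReal.pow_right_strictMono two_ne_zero).le_iff_le.symm
  rw [hsq, seqNorm, l2_sq, ENNReal.tsum_eq_iSup_sum, iSup_le_iff]
  simp only [hsq (y := C), enorm_weightedRestrict_sq]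

lemma isClosed_setOf_seqNorm_coeff_le (s : ℝ) (C : ℝ≥0∞) :
    IsClosed {f : L2 d | seqNorm s (coeff f) ≤ C} := by
  simp only [seqNorm_le_iff, Set.ofPred_forall]
  exact isClosed_iInter fun S => isClosed_le ((continuous_weightedRestrict s S).comp
    (continuous_pi continuous_coeff)).enorm continuous_const

lemma seqNorm_sub_le_of_hasDerivAt {s T : ℝ} {C : ℝ≥0} (hT : 0 ≤ T)
    {a a' : ℝ → Freq d → ℂ} (ha : ContinuousOn a (Set.Icc 0 T))
    (ha' : ∀ t ∈ Set.Ioo 0 T, ∀ ξ, HasDerivAt (fun t => a t ξ) (a' t ξ) t)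
    (hC : ∀ t ∈ Set.Ioo 0 T, seqNorm s (a' t) ≤ C) :
    seqNorm s (a T - a 0) ≤ C * ENNReal.ofReal T := by
  obtain rfl | hT := hT.eq_or_lt
  · simp [seqNorm_zero]
  refine seqNorm_le_iff.2 fun S => ?_
  have hlip := (convex_Ioo 0 T).lipschitzOnWith_of_nnnorm_hasDerivWithin_le
    (fun t ht => (hasDerivAt_weightedRestrict s S (ha' t ht)).hasDerivWithinAt)
    fun t ht => ENNReal.coe_le_coe.1 (seqNorm_le_iff.1 (hC t ht) S)
  have hcont : ContinuousOn (fun t => weightedRestrict s S (a t)) (closure (Set.Ioo 0 T)) := by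
    rw [closure_Ioo hT.ne]
    exact (continuous_weightedRestrict s S).comp_continuousOn ha
  have h := hlip.closure hcont
  rw [closure_Ioo hT.ne] at h
  calc ‖weightedRestrict s S (a T - a 0)‖ₑ
      = edist (weightedRestrict s S (a T)) (weightedRestrict s S (a 0)) := by
        rw [weightedRestrict_sub, edist_eq_enorm_sub]
    _ ≤ C * edist T 0 := h (Set.right_mem_Icc.2 hT.le) (Set.left_mem_Icc.2 hT.le)
    _ = C * ENNReal.ofReal T := by rw [edist_dist, Real.dist_0_eq_abs, abs_of_pos hT]

variable (d) in
/-- The factor `(2π)^{d/2}` between `sobolevNorm` and `seqNorm`. -/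
def sobolevFactor : ℝ := (2 * Real.pi) ^ ((d : ℝ) / 2)

lemma sobolevFactor_pos : 0 < sobolevFactor d := Real.rpow_pos_of_pos Real.two_pi_pos _

lemma sobolevNorm_eq (s : ℝ) (f : L2 d) :
    sobolevNorm s f = ENNReal.ofReal (sobolevFactor d) * seqNorm s (coeff f) := by
  rw [sobolevNorm, seqNorm, l2]
  congr 3 with ξ
  rw [mul_pow, wt_sq, ENNReal.ofReal_mul (Real.rpow_nonneg (one_add_freqSq_pos ξ).le _),
    ENNReal.ofReal_pow (norm_nonneg _), ofReal_norm]

lemma mapsTo_Icc_of_ae_mem_of_isClosed {X : Type*} [TopologicalSpace X] {T : ℝ} (hT : 0 < T)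
    {u : ℝ → X} (hu : ContinuousOn u (Set.Icc 0 T)) {s : Set X} (hs : IsClosed s)
    (h : ∀ᵐ t ∂volume.restrict (Set.Ioo 0 T), u t ∈ s) : Set.MapsTo u (Set.Icc 0 T) s := by
  rw [ae_restrict_iff' measurableSet_Ioo] at h
  have hdense := closure_minimal ((Measure.dense_of_ae h).open_subset_closure_inter
    (isOpen_Ioo (a := 0) (b := T))) isClosed_closure
  rw [closure_Ioo hT.ne] at hdense
  intro t ht
  have hcont := (hu t ht).mono
    ((Set.inter_subset_left (t := {r | r ∈ Set.Ioo 0 T → u r ∈ s})).trans Set.Ioo_subset_Icc_self)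
  exact hs.closure_subset (hcont.mem_closure (hdense ht) fun r hr => hr.2 hr.1)

lemma seqNorm_coeff_le_of_supSobolevNorm_le {s T : ℝ} (hT : 0 < T) {u : ℝ → L2 d}
    (hu : ContinuousOn u (Set.Icc 0 T)) {M : ℝ≥0∞} (hM : supSobolevNorm s T u ≤ M) {t : ℝ}
    (ht : t ∈ Set.Icc 0 T) :
    seqNorm s (coeff (u t)) ≤ M / ENNReal.ofReal (sobolevFactor d) := by
  refine mapsTo_Icc_of_ae_mem_of_isClosed hT hu (isClosed_setOf_seqNorm_coeff_le s _) ?_ ht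
  filter_upwards [ENNReal.ae_le_essSup fun t => sobolevNorm s (u t)] with t ht
  rw [ENNReal.le_div_iff_mul_le
    (.inl (ENNReal.ofReal_pos.2 sobolevFactor_pos).ne') (.inl ENNReal.ofReal_ne_top), mul_comm,
    ← sobolevNorm_eq]
  exact ht.trans hM

end Regularity

/-! ### The symbols of the scheme -/

section Phi

open Complex

lemma norm_exp_two_I (s x : ℝ) : ‖exp (2 * I * s * x)‖ = 1 := by
  rw [show (2 * I * s * x : ℂ) = ((2 * s * x : ℝ) : ℂ) * I by push_cast; ring]
  exact norm_exp_ofReal_mul_I _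

lemma hasDerivAt_two_I_mul (x s : ℝ) :
    HasDerivAt (fun s : ℝ => 2 * I * (s : ℂ) * x) (2 * I * x) s := by
  simpa using (((hasDerivAt_id s).ofReal_comp).const_mul (2 * I)).mul_const (x : ℂ)

lemma hasDerivAt_mul_phi (x s : ℝ) :
    HasDerivAt (fun s : ℝ => (s : ℂ) * phi (2 * I * s * x)) (exp (2 * I * s * x)) s := by
  rcases eq_or_ne x 0 with rfl | hx
  · simpa [phi] using (hasDerivAt_id s).ofReal_comp
  have hx' : (2 * I * x : ℂ) ≠ 0 := by simp [hx]
  have hformula : (fun s : ℝ => (s : ℂ) * phi (2 * I * s * x))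
      = fun s : ℝ => (exp (2 * I * s * x) - 1) / (2 * I * x) := by
    ext r
    rcases eq_or_ne r 0 with rfl | hr
    · simp
    have hr' : (r : ℂ) ≠ 0 := by exact_mod_cast hr
    rw [phi, if_neg (by simp [hr, hx])]
    field_simp
  rw [hformula]
  have h := ((hasDerivAt_two_I_mul x s).cexp.sub_const 1).div_const (2 * I * x)
  rwa [mul_div_assoc, div_self hx', mul_one] at h

lemma hasDerivAt_sq_mul_psi (x s : ℝ) :
    HasDerivAt (fun s : ℝ => -(s : ℂ) ^ 2 * psi (2 * I * s * x)) (s * exp (2 * I * s * x)) s := by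
  rcases eq_or_ne x 0 with rfl | hx
  · simp only [psi, ofReal_zero, mul_zero, if_true, Complex.exp_zero]
    exact (((hasDerivAt_id s).ofReal_comp.pow 2).neg.mul_const (-1 / 2 : ℂ)).congr_deriv
      (by simp only [id]; push_cast; ring)
  have hx' : (x : ℂ) ≠ 0 := by exact_mod_cast hx
  have hI := I_ne_zero
  have hformula : (fun s : ℝ => -(s : ℂ) ^ 2 * psi (2 * I * s * x))
      = fun s : ℝ => (2 * I * s * x * exp (2 * I * s * x) - exp (2 * I * s * x) + 1)
          / (2 * I * x) ^ 2 := by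
    ext r
    rcases eq_or_ne r 0 with rfl | hr
    · simp
    have hr' : (r : ℂ) ≠ 0 := by exact_mod_cast hr
    rw [psi, if_neg (by simp [hr, hx])]
    field_simp
    ring
  rw [hformula]
  have hlin := hasDerivAt_two_I_mul x s
  refine ((((hlin.mul hlin.cexp).sub hlin.cexp).add_const 1).div_const
    ((2 * I * x) ^ 2)).congr_deriv ?_
  field_simp
  ring

lemma norm_phi_le (x : ℝ) : ‖phi (2 * I * x)‖ ≤ 1 := by
  simpa using norm_image_sub_le_of_norm_deriv_le_segment_01'
    (fun s _ => (hasDerivAt_mul_phi x s).hasDerivWithinAt) fun s _ => (norm_exp_two_I s x).le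

lemma norm_psi_le (x : ℝ) : ‖psi (2 * I * x)‖ ≤ 1 := by
  simpa using norm_image_sub_le_of_norm_deriv_le_segment_01' (C := 1)
    (fun s _ => (hasDerivAt_sq_mul_psi x s).hasDerivWithinAt) fun s hs => by
      rw [norm_mul, norm_exp_two_I, mul_one, norm_real, Real.norm_of_nonneg hs.1]
      exact hs.2.le

lemma norm_exp_I_mul (x : ℝ) : ‖exp (I * x)‖ = 1 := by
  rw [mul_comm]; exact norm_exp_ofReal_mul_I x

lemma norm_exp_I_mul_sub_one_sub_le (x : ℝ) : ‖exp (I * x) - 1 - I * x‖ ≤ 2 * x ^ 2 := by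
  have hnorm : ‖(I * x : ℂ)‖ = |x| := by simp
  rcases le_or_gt |x| 1 with hx | hx
  · have h := norm_exp_sub_one_sub_id_le (x := I * x) (hnorm.trans_le hx)
    rw [hnorm, sq_abs] at h
    linarith [sq_nonneg x]
  · calc ‖exp (I * x) - 1 - I * x‖ ≤ ‖exp (I * x) - 1‖ + ‖I * x‖ := norm_sub_le _ _
      _ ≤ |x| + |x| := add_le_add Real.norm_exp_I_mul_ofReal_sub_one_le hnorm.le
      _ ≤ 2 * x ^ 2 := by rw [← sq_abs x]; nlinarith

end Phi

section Symbols

open Complex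

variable {d : ℕ}

/-- The resonance function `|ξ + η + ζ|² - |ξ|² - |η|² - |ζ|²`. -/
def beta (ξ η ζ : Freq d) : ℝ := freqSq (ξ + η + ζ) - freqSq ξ - freqSq η - freqSq ζ

lemma beta_eq (ξ η ζ : Freq d) :
    beta ξ η ζ = 2 * (∑ j, (ξ j : ℝ) * η j + ∑ j, (ξ j : ℝ) * ζ j + ∑ j, (η j : ℝ) * ζ j) := by
  simp only [beta, freqSq, ← Finset.sum_sub_distrib, ← Finset.sum_add_distrib, Finset.mul_sum]
  refine Finset.sum_congr rfl fun j _ => ?_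
  push_cast [Pi.add_apply]; ring

lemma sq_beta_le (ξ η ζ : Freq d) :
    beta ξ η ζ ^ 2 ≤ 12 * ((1 + freqSq ξ) * (1 + freqSq η) * (1 + freqSq ζ)) := by
  have cauchy_schwarz (ξ η : Freq d) : (∑ j, (ξ j : ℝ) * η j) ^ 2 ≤ freqSq ξ * freqSq η :=
    Finset.sum_mul_sq_le_sq_mul_sq _ _ _
  have hξη := cauchy_schwarz ξ η
  have hξζ := cauchy_schwarz ξ ζ
  have hηζ := cauchy_schwarz η ζ
  rw [beta_eq]
  set A := ∑ j, (ξ j : ℝ) * η j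
  set B := ∑ j, (ξ j : ℝ) * ζ j
  set C := ∑ j, (η j : ℝ) * ζ j
  have hξ := freqSq_nonneg ξ
  have hη := freqSq_nonneg η
  have hζ := freqSq_nonneg ζ
  calc (2 * (A + B + C)) ^ 2 ≤ 12 * (A ^ 2 + B ^ 2 + C ^ 2) := by
        linarith [sq_nonneg (A - B), sq_nonneg (A - C), sq_nonneg (B - C)]
    _ ≤ 12 * (freqSq ξ * freqSq η + freqSq ξ * freqSq ζ + freqSq η * freqSq ζ) := by gcongr
    _ ≤ 12 * ((1 + freqSq ξ) * (1 + freqSq η) * (1 + freqSq ζ)) := by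
        linarith [mul_nonneg (mul_nonneg hξ hη) hζ]

/-- The phase `|ξ + η + ζ|² + |ξ|² - |η|² - |ζ|²` of the cubic nonlinearity; `ξ` is the frequency
of the conjugated factor. -/
def alpha (ξ η ζ : Freq d) : ℝ := 2 * freqSq ξ + beta ξ η ζ

lemma abs_alpha_le (ξ η ζ : Freq d) :
    |alpha ξ η ζ| ≤ 4 * ((1 + freqSq ξ) * (1 + freqSq η) * (1 + freqSq ζ)) := by
  have hξ := freqSq_nonneg ξ
  have hη := freqSq_nonneg η
  have hζ := freqSq_nonneg ζ
  have hsum := freqSq_nonneg (ξ + η + ζ)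
  have htriple : freqSq (ξ + η + ζ) ≤ 2 * freqSq ξ + 4 * freqSq η + 4 * freqSq ζ := by
    rw [add_assoc]
    linarith [freqSq_add_le ξ (η + ζ), freqSq_add_le η ζ]
  have hprod := mul_nonneg (mul_nonneg hξ hη) hζ
  rw [alpha, beta, abs_le]
  constructor <;> nlinarith [mul_nonneg hξ hη, mul_nonneg hξ hζ, mul_nonneg hη hζ]

lemma symbolBound_two {B : ℝ≥0} {m : Symbol (Freq d)}
    (h : ∀ ξ η ζ, ‖m ξ η ζ‖ ≤ B * ((1 + freqSq ξ) * (1 + freqSq η) * (1 + freqSq ζ))) :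
    SymbolBound 2 B m := fun ξ η ζ => by
  have hξ := one_add_freqSq_pos ξ
  have hη := one_add_freqSq_pos η
  rw [wt_two, wt_two, wt_two, ← ENNReal.ofReal_mul hξ.le, ← ENNReal.ofReal_mul (by positivity),
    ← ENNReal.ofReal_coe_nnreal, ← ENNReal.ofReal_mul B.coe_nonneg, ← ofReal_norm]
  exact ENNReal.ofReal_le_ofReal (h ξ η ζ)

lemma symbolBound_one : SymbolBound 0 1 (1 : Symbol (Freq d)) := symbolBound_zero.2 (by simp)

/-- The symbol of the nonlinearity in the interaction picture. -/
def phaseSymbol (s : ℝ) : Symbol (Freq d) := fun ξ η ζ => exp (I * (s * alpha ξ η ζ : ℝ))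

/-- The approximation of `phaseSymbol s`, for `s ∈ [0, τ]`, in which `e^{isβ}` is replaced by its
linear interpolation between `s = 0` and `s = τ`. -/
def approxSymbol (τ s : ℝ) : Symbol (Freq d) := fun ξ η ζ =>
  exp (2 * I * s * freqSq ξ) + (s * exp (2 * I * s * freqSq ξ)) *
    ((exp (I * (τ * beta ξ η ζ : ℝ)) - 1) / τ)

/-- The primitive of `approxSymbol τ` that vanishes at `0`. -/
def primSymbol (τ s : ℝ) : Symbol (Freq d) := fun ξ η ζ =>
  s * phi (2 * I * s * freqSq ξ) + (-(s : ℂ) ^ 2 * psi (2 * I * s * freqSq ξ)) *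
    ((exp (I * (τ * beta ξ η ζ : ℝ)) - 1) / τ)

lemma hasDerivAt_primSymbol (τ s : ℝ) (ξ η ζ : Freq d) :
    HasDerivAt (fun s => primSymbol τ s ξ η ζ) (approxSymbol τ s ξ η ζ) s :=
  (hasDerivAt_mul_phi _ s).add ((hasDerivAt_sq_mul_psi _ s).mul_const _)

lemma primSymbol_zero (τ : ℝ) : primSymbol τ 0 = (0 : Symbol (Freq d)) := by
  ext ξ η ζ; simp [primSymbol]

lemma phaseSymbol_eq (s : ℝ) (ξ η ζ : Freq d) :
    phaseSymbol s ξ η ζ = exp (2 * I * s * freqSq ξ) * exp (I * (s * beta ξ η ζ : ℝ)) := by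
  rw [phaseSymbol, ← Complex.exp_add, alpha]; congr 1; push_cast; ring

lemma symbolBound_phaseSymbol (s : ℝ) : SymbolBound 0 1 (phaseSymbol s : Symbol (Freq d)) :=
  symbolBound_zero.2 fun _ _ _ => (norm_exp_I_mul _).le

lemma norm_exp_I_mul_sub_one_div_le {τ : ℝ} (hτ : 0 < τ) (x : ℝ) :
    ‖(exp (I * x) - 1) / τ‖ ≤ 2 / τ := by
  rw [norm_div, norm_real, Real.norm_of_nonneg hτ.le]
  gcongr
  refine (norm_sub_le _ _).trans ?_
  rw [norm_exp_I_mul, norm_one]; norm_num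

lemma symbolBound_approxSymbol {τ s : ℝ} (hτ : 0 < τ) (hs : |s| ≤ 2 * τ) :
    SymbolBound 0 5 (approxSymbol τ s : Symbol (Freq d)) :=
  symbolBound_zero.2 fun ξ η ζ => by
    rw [← NNReal.coe_le_coe, coe_nnnorm]
    calc ‖approxSymbol τ s ξ η ζ‖ ≤ 1 + |s| * (2 / τ) := by
          refine (norm_add_le _ _).trans ?_
          rw [norm_mul, norm_mul, norm_exp_two_I, norm_real, Real.norm_eq_abs, mul_one]
          gcongr
          exact norm_exp_I_mul_sub_one_div_le hτ _
      _ ≤ 1 + 2 * τ * (2 / τ) := by gcongr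
      _ = 5 := by field_simp; norm_num

lemma symbolBound_primSymbol {τ : ℝ} (hτ : 0 < τ) :
    SymbolBound 0 (5 * τ.toNNReal) (primSymbol τ τ : Symbol (Freq d)) :=
  symbolBound_zero.2 fun ξ η ζ => by
    have hphi := norm_phi_le (τ * freqSq ξ)
    have hpsi := norm_psi_le (τ * freqSq ξ)
    push_cast [← mul_assoc] at hphi hpsi
    rw [← NNReal.coe_le_coe, coe_nnnorm, NNReal.coe_mul, Real.coe_toNNReal τ hτ.le,
      NNReal.coe_ofNat]
    calc ‖primSymbol τ τ ξ η ζ‖ ≤ τ * 1 + τ ^ 2 * 1 * (2 / τ) := by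
          refine (norm_add_le _ _).trans ?_
          rw [norm_mul, norm_mul, norm_mul, norm_neg, norm_pow, norm_real,
            Real.norm_of_nonneg hτ.le]
          gcongr
          exact norm_exp_I_mul_sub_one_div_le hτ _
      _ = 3 * τ := by field_simp; norm_num
      _ ≤ 5 * τ := by gcongr; norm_num

lemma symbolBound_phaseSymbol_sub_one {s : ℝ} (hs : 0 ≤ s) :
    SymbolBound 2 (4 * s.toNNReal) (phaseSymbol s - 1 : Symbol (Freq d)) :=
  symbolBound_two fun ξ η ζ => by
    rw [NNReal.coe_mul, Real.coe_toNNReal s hs, NNReal.coe_ofNat]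
    calc ‖phaseSymbol s ξ η ζ - 1‖ ≤ |s * alpha ξ η ζ| := Real.norm_exp_I_mul_ofReal_sub_one_le
      _ = s * |alpha ξ η ζ| := by rw [abs_mul, abs_of_nonneg hs]
      _ ≤ s * (4 * ((1 + freqSq ξ) * (1 + freqSq η) * (1 + freqSq ζ))) := by
          gcongr; exact abs_alpha_le ξ η ζ
      _ = 4 * s * ((1 + freqSq ξ) * (1 + freqSq η) * (1 + freqSq ζ)) := by ring

lemma symbolBound_phaseSymbol_sub_approxSymbol {τ s : ℝ} (hτ : 0 < τ) (hs : 0 ≤ s) (hsτ : s ≤ τ) :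
    SymbolBound 2 (48 * τ.toNNReal ^ 2) (phaseSymbol s - approxSymbol τ s : Symbol (Freq d)) :=
  symbolBound_two fun ξ η ζ => by
    set b := beta ξ η ζ with hb
    have hτ' : (τ : ℂ) ≠ 0 := by exact_mod_cast hτ.ne'
    have remainder : phaseSymbol s ξ η ζ - approxSymbol τ s ξ η ζ = exp (2 * I * s * freqSq ξ) *
        ((exp (I * (s * b : ℝ)) - 1 - I * (s * b : ℝ))
          - (s / τ : ℝ) * (exp (I * (τ * b : ℝ)) - 1 - I * (τ * b : ℝ))) := by
      rw [phaseSymbol_eq, approxSymbol, ← hb]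
      push_cast
      field_simp
      ring
    have hratio : ‖((s / τ : ℝ) : ℂ)‖ ≤ 1 := by
      rw [norm_real, Real.norm_of_nonneg (by positivity)]; exact (div_le_one hτ).2 hsτ
    simp only [Pi.sub_apply, NNReal.coe_mul, NNReal.coe_pow, Real.coe_toNNReal τ hτ.le,
      NNReal.coe_ofNat]
    calc ‖phaseSymbol s ξ η ζ - approxSymbol τ s ξ η ζ‖
        ≤ 2 * (s * b) ^ 2 + 1 * (2 * (τ * b) ^ 2) := by
          rw [remainder, norm_mul, norm_exp_two_I, one_mul]
          refine (norm_sub_le _ _).trans (add_le_add (norm_exp_I_mul_sub_one_sub_le _) ?_)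
          rw [norm_mul]
          gcongr
          exact norm_exp_I_mul_sub_one_sub_le _
      _ ≤ 4 * (τ ^ 2 * b ^ 2) := by
          have : (s * b) ^ 2 ≤ (τ * b) ^ 2 := by rw [mul_pow, mul_pow]; gcongr
          linarith [mul_pow τ b 2]
      _ ≤ 4 * (τ ^ 2 * (12 * ((1 + freqSq ξ) * (1 + freqSq η) * (1 + freqSq ζ)))) := by
          gcongr; exact sq_beta_le ξ η ζ
      _ = 48 * τ ^ 2 * ((1 + freqSq ξ) * (1 + freqSq η) * (1 + freqSq ζ)) := by ring

end Symbols

/-! ### The cubic nonlinearity -/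

section Cubic

variable {d : ℕ} {γ σ : ℝ} {B : ℝ≥0} {m m' : Symbol (Freq d)}

/-- The Fourier coefficients of the cubic nonlinearity `|f|² f`, with symbol `m`. -/
def cubicMap (m : Symbol (Freq d)) (a : Freq d → ℂ) : Freq d → ℂ := tri m (cstar a) a a

/-- The Fourier coefficients of `|f|² f`. -/
def cubic : (Freq d → ℂ) → Freq d → ℂ := cubicMap 1

/-- The Fourier coefficients of `|f|⁴ f`. -/
def quintic (a : Freq d → ℂ) : Freq d → ℂ := tri 1 (cstar a) (cubic a) a

/-- The part of `cubicMap m (w + δ)` that is linear in `δ`. -/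
def triLin (m : Symbol (Freq d)) (w δ : Freq d → ℂ) : Freq d → ℂ :=
  tri m (cstar δ) w w + tri m (cstar w) δ w + tri m (cstar w) w δ

/-- The part of `cubicMap m (w + δ)` that is at least quadratic in `δ`. -/
def triQuad (m : Symbol (Freq d)) (w δ : Freq d → ℂ) : Freq d → ℂ :=
  tri m (cstar δ) δ (w + δ) + tri m (cstar δ) w δ + tri m (cstar w) δ δ

lemma cubicMap_add (hm : IsBoundedSymbol m) {w δ : Freq d → ℂ} (hw : Summable w)
    (hδ : Summable δ) :
    cubicMap m (w + δ) = cubicMap m w + triLin m w δ + triQuad m w δ := by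
  have hw' := summable_cstar hw
  have hδ' := summable_cstar hδ
  have hwδ : Summable (w + δ) := hw.add hδ
  rw [cubicMap, cstar_add, tri_add_left hm hw' hδ' hwδ hwδ, tri_add_mid hm hw' hw hδ hwδ,
    tri_add_mid hm hδ' hw hδ hwδ, tri_add_right hm hw' hw hw hδ, tri_add_right hm hw' hδ hw hδ,
    tri_add_right hm hδ' hw hw hδ, cubicMap, triLin, triQuad]
  abel

lemma triLin_sub (hm : IsBoundedSymbol m) {w x y : Freq d → ℂ} (hw : Summable w)
    (hx : Summable x) (hy : Summable y) :
    triLin m w (x - y) = triLin m w x - triLin m w y := by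
  have hw' := summable_cstar hw
  have hxy : Summable (x - y) := hx.sub hy
  rw [eq_sub_iff_add_eq]
  conv_rhs => rw [← sub_add_cancel x y]
  rw [triLin, triLin, triLin, cstar_add,
    tri_add_left hm (summable_cstar hxy) (summable_cstar hy) hw hw,
    tri_add_mid hm hw' hxy hy hw, tri_add_right hm hw' hw hxy hy]
  abel

lemma triLin_sub_symbol (hm : IsBoundedSymbol m) (hm' : IsBoundedSymbol m') {w x : Freq d → ℂ}
    (hw : Summable w) (hx : Summable x) :
    triLin (m - m') w x = triLin m w x - triLin m' w x := by
  have hw' := summable_cstar hw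
  rw [triLin, tri_sub_symbol hm hm' (summable_cstar hx) hw hw, tri_sub_symbol hm hm' hw' hx hw,
    tri_sub_symbol hm hm' hw' hw hx, triLin, triLin]
  abel

lemma cubicMap_add_sub_cubicMap_sub_triLin (hm : IsBoundedSymbol m) (hm' : IsBoundedSymbol m')
    {w δ p : Freq d → ℂ} (hw : Summable w) (hδ : Summable δ) (hp : Summable p) :
    cubicMap m (w + δ) - cubicMap m' w - triLin 1 w p
      = cubicMap (m - m') w + triLin m w (δ - p) + triLin (m - 1) w p + triQuad m w δ := by
  rw [cubicMap_add hm hw hδ, triLin_sub hm hw hδ hp,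
    triLin_sub_symbol hm isBoundedSymbol_one hw hp, cubicMap, cubicMap, cubicMap,
    tri_sub_symbol hm hm' (summable_cstar hw) hw hw]
  abel

lemma tri_sub_tri (hm : IsBoundedSymbol m) {a b c a' b' c' : Freq d → ℂ}
    (ha : Summable a) (hb : Summable b) (hc : Summable c)
    (ha' : Summable a') (hb' : Summable b') (hc' : Summable c') :
    tri m a b c - tri m a' b' c'
      = tri m (a - a') b c + tri m a' (b - b') c + tri m a' b' (c - c') := by
  have hleft := tri_add_left (a := a - a') hm (ha.sub ha') ha' hb hc
  have hmid := tri_add_mid (b := b - b') hm ha' (hb.sub hb') hb' hc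
  have hright := tri_add_right (c := c - c') hm ha' hb' (hc.sub hc') hc'
  rw [sub_add_cancel] at hleft hmid hright
  rw [hleft, hmid, hright]
  abel

lemma seqNorm_tri_sub_tri_le (hγ : (d : ℝ) / 2 < γ) (hm : SymbolBound 0 B m)
    {a b c a' b' c' : Freq d → ℂ} {R : ℝ≥0} {D : ℝ≥0∞}
    (ha : seqNorm γ a ≤ R) (hb : seqNorm γ b ≤ R) (hc : seqNorm γ c ≤ R)
    (ha' : seqNorm γ a' ≤ R) (hb' : seqNorm γ b' ≤ R) (hc' : seqNorm γ c' ≤ R)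
    (hleft : seqNorm γ (a - a') ≤ D) (hmid : seqNorm γ (b - b') ≤ D)
    (hright : seqNorm γ (c - c') ≤ D) :
    seqNorm γ (tri m a b c - tri m a' b' c') ≤ 3 * triConst d γ * B * R ^ 2 * D := by
  have summable {x : Freq d → ℂ} (hx : seqNorm γ x ≤ R) : Summable x :=
    summable_of_seqNorm_ne_top hγ (ne_top_of_le_ne_top ENNReal.coe_ne_top hx)
  rw [tri_sub_tri hm.isBoundedSymbol (summable ha) (summable hb) (summable hc) (summable ha')
    (summable hb') (summable hc')]
  calc seqNorm γ (tri m (a - a') b c + tri m a' (b - b') c + tri m a' b' (c - c'))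
      ≤ triConst d γ * B * (D * R * R) + triConst d γ * B * (R * D * R)
          + triConst d γ * B * (R * R * D) := by
        refine (seqNorm_add_le _ _ _).trans (add_le_add ((seqNorm_add_le _ _ _).trans
          (add_le_add ?_ ?_)) ?_) <;>
        · refine (seqNorm_tri_le hγ hm _ _ _).trans ?_
          rw [add_zero]
          gcongr
    _ = 3 * triConst d γ * B * R ^ 2 * D := by ring

lemma seqNorm_cubicMap_sub_le (hγ : (d : ℝ) / 2 < γ) (hm : SymbolBound 0 B m)
    {a b : Freq d → ℂ} {R : ℝ≥0} (ha : seqNorm γ a ≤ R) (hb : seqNorm γ b ≤ R) :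
    seqNorm γ (cubicMap m a - cubicMap m b)
      ≤ 3 * triConst d γ * B * R ^ 2 * seqNorm γ (a - b) := by
  refine seqNorm_tri_sub_tri_le hγ hm ?_ ha ha ?_ hb hb ?_ le_rfl le_rfl
  · rwa [seqNorm_cstar]
  · rwa [seqNorm_cstar]
  · rw [← cstar_sub, seqNorm_cstar]

lemma seqNorm_cubicMap_le (hγ : (d : ℝ) / 2 < γ) (hm : SymbolBound σ B m) {a : Freq d → ℂ}
    {R : ℝ≥0∞} (ha : seqNorm (γ + σ) a ≤ R) :
    seqNorm γ (cubicMap m a) ≤ triConst d γ * B * R ^ 3 := by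
  calc seqNorm γ (cubicMap m a) ≤ triConst d γ * B * (R * R * R) := by
        refine (seqNorm_tri_le hγ hm _ _ _).trans ?_
        rw [seqNorm_cstar]
        gcongr
    _ = triConst d γ * B * R ^ 3 := by ring

lemma seqNorm_triLin_le (hγ : (d : ℝ) / 2 < γ) (hm : SymbolBound σ B m) {w δ : Freq d → ℂ}
    {R D : ℝ≥0∞} (hw : seqNorm (γ + σ) w ≤ R) (hδ : seqNorm (γ + σ) δ ≤ D) :
    seqNorm γ (triLin m w δ) ≤ 3 * triConst d γ * B * R ^ 2 * D := by
  calc seqNorm γ (triLin m w δ)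
      ≤ triConst d γ * B * (D * R * R) + triConst d γ * B * (R * D * R)
          + triConst d γ * B * (R * R * D) := by
        refine (seqNorm_add_le _ _ _).trans (add_le_add ((seqNorm_add_le _ _ _).trans
          (add_le_add ?_ ?_)) ?_) <;>
        · refine (seqNorm_tri_le hγ hm _ _ _).trans ?_
          rw [seqNorm_cstar]
          gcongr
    _ = 3 * triConst d γ * B * R ^ 2 * D := by ring

lemma seqNorm_triQuad_le (hγ : (d : ℝ) / 2 < γ) (hm : SymbolBound σ B m) {w δ : Freq d → ℂ}
    {R D : ℝ≥0∞} (hw : seqNorm (γ + σ) w ≤ R) (hwδ : seqNorm (γ + σ) (w + δ) ≤ R)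
    (hδ : seqNorm (γ + σ) δ ≤ D) :
    seqNorm γ (triQuad m w δ) ≤ 3 * triConst d γ * B * R * D ^ 2 := by
  calc seqNorm γ (triQuad m w δ)
      ≤ triConst d γ * B * (D * D * R) + triConst d γ * B * (D * R * D)
          + triConst d γ * B * (R * D * D) := by
        refine (seqNorm_add_le _ _ _).trans (add_le_add ((seqNorm_add_le _ _ _).trans
          (add_le_add ?_ ?_)) ?_) <;>
        · refine (seqNorm_tri_le hγ hm _ _ _).trans ?_
          rw [seqNorm_cstar]
          gcongr
    _ = 3 * triConst d γ * B * R * D ^ 2 := by ring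

lemma seqNorm_cubicMap_add_sub_le (hγ : (d : ℝ) / 2 < γ) {B₁ B₂ : ℝ≥0}
    (hm : SymbolBound 0 B m) (hm' : IsBoundedSymbol m') (hm_one : SymbolBound σ B₁ (m - 1))
    (hm_sub : SymbolBound σ B₂ (m - m')) (hσ : 0 ≤ σ) {w δ p : Freq d → ℂ} {M P : ℝ≥0}
    {D E : ℝ≥0∞} (hw : seqNorm (γ + σ) w ≤ M) (hwδ : seqNorm γ (w + δ) ≤ M)
    (hδ : seqNorm γ δ ≤ D) (hp : seqNorm (γ + σ) p ≤ P) (hδp : seqNorm γ (δ - p) ≤ E) :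
    seqNorm γ (cubicMap m (w + δ) - cubicMap m' w - triLin 1 w p)
      ≤ triConst d γ * B₂ * M ^ 3 + 3 * triConst d γ * B * M ^ 2 * E
          + 3 * triConst d γ * B₁ * M ^ 2 * P + 3 * triConst d γ * B * M * D ^ 2 := by
  have summable {x : Freq d → ℂ} {R : ℝ≥0} (hx : seqNorm γ x ≤ R) : Summable x :=
    summable_of_seqNorm_ne_top hγ (ne_top_of_le_ne_top ENNReal.coe_ne_top hx)
  have lower {x : Freq d → ℂ} : seqNorm γ x ≤ seqNorm (γ + σ) x :=
    seqNorm_mono_exponent (by linarith) x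
  have hw0 := lower.trans hw
  have hδ_summable : Summable δ := by
    simpa using (summable hwδ).sub (summable hw0)
  rw [cubicMap_add_sub_cubicMap_sub_triLin hm.isBoundedSymbol hm' (summable hw0) hδ_summable
    (summable (lower.trans hp))]
  refine (seqNorm_add_le _ _ _).trans (add_le_add ((seqNorm_add_le _ _ _).trans
    (add_le_add ((seqNorm_add_le _ _ _).trans (add_le_add ?_ ?_)) ?_)) ?_)
  · exact seqNorm_cubicMap_le hγ hm_sub hw
  · exact seqNorm_triLin_le hγ hm (by rwa [add_zero]) (by rwa [add_zero])
  · exact seqNorm_triLin_le hγ hm_one hw hp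
  · exact seqNorm_triQuad_le hγ hm (by rwa [add_zero]) (by rwa [add_zero]) (by rwa [add_zero])

lemma seqNorm_cubic_le (hγ : (d : ℝ) / 2 < γ) {a : Freq d → ℂ} {R : ℝ≥0∞}
    (ha : seqNorm γ a ≤ R) : seqNorm γ (cubic a) ≤ triConst d γ * R ^ 3 := by
  simpa [cubic] using seqNorm_cubicMap_le hγ symbolBound_one (a := a) (R := R) (by rwa [add_zero])

lemma seqNorm_cubic_sub_le (hγ : (d : ℝ) / 2 < γ) {a b : Freq d → ℂ} {R : ℝ≥0}
    (ha : seqNorm γ a ≤ R) (hb : seqNorm γ b ≤ R) :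
    seqNorm γ (cubic a - cubic b) ≤ 3 * triConst d γ * R ^ 2 * seqNorm γ (a - b) := by
  simpa [cubic] using seqNorm_cubicMap_sub_le hγ symbolBound_one ha hb

lemma HasFourier.cubic {f : Torus d → ℂ} {a : Freq d → ℂ} (h : HasFourier f a) :
    HasFourier (fun x => conj (f x) * f x * f x) (cubic a) := h.conjugate.mul_mul h h

lemma tri_cstar_cubic {a : Freq d → ℂ} (ha : Summable a) :
    tri 1 (cstar (cubic a)) a a = quintic a := by
  have h := HasFourier.of_fourierSum ha
  refine (h.cubic.conjugate.mul_mul h h).unique ((h.conjugate.mul_mul h.cubic h).congr ?_)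
  refine Filter.Eventually.of_forall fun x => ?_
  simp only [map_mul, Complex.conj_conj]
  ring

lemma tri_cubic_right {a : Freq d → ℂ} (ha : Summable a) :
    tri 1 (cstar a) a (cubic a) = quintic a := by
  have h := HasFourier.of_fourierSum ha
  refine (h.conjugate.mul_mul h h.cubic).unique ((h.conjugate.mul_mul h.cubic h).congr ?_)
  refine Filter.Eventually.of_forall fun x => ?_
  ring

lemma triLin_I_smul_cubic (s : ℝ) {w : Freq d → ℂ} (hw : Summable w) :
    triLin 1 w ((Complex.I * s) • cubic w) = (Complex.I * s) • quintic w := by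
  have hcstar : cstar ((Complex.I * s) • cubic w) = (-(Complex.I * s)) • cstar (cubic w) := by
    ext ξ; simp [cstar]
  rw [triLin, hcstar, tri_smul_left, tri_smul_mid, tri_smul_right, tri_cstar_cubic hw,
    tri_cubic_right hw, ← quintic]
  module

end Cubic

/-! ### The local error -/

section LocalError

open Set

variable {d : ℕ} {γ τ s : ℝ} {M : ℝ≥0} {v : ℝ → Freq d → ℂ}

/-- One step of the integrator in the interaction picture, on the Fourier side. -/
def stepSeq (τ : ℝ) (a : Freq d → ℂ) : Freq d → ℂ :=
  a + Complex.I • cubicMap (primSymbol τ τ) a - ((τ : ℂ) ^ 2 / 2) • quintic a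

lemma hasDerivAt_tri_primSymbol (hτ : 0 < τ) (hs : |s| < 2 * τ) {a b c : Freq d → ℂ}
    (ha : Summable a) (hb : Summable b) (hc : Summable c) (ξ : Freq d) :
    HasDerivAt (fun s => tri (primSymbol τ s) a b c ξ) (tri (approxSymbol τ s) a b c ξ) s := by
  refine hasDerivAt_tsum_of_isPreconnected (t := Metric.ball 0 (2 * τ)) (y₀ := 0)
    ((summable_triTerm isBoundedSymbol_one ha hb hc ξ).norm.mul_left 5)
    Metric.isOpen_ball (convex_ball 0 _).isPreconnected
    (fun p y _ => (hasDerivAt_primSymbol τ y _ _ _).mul_const _) ?_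
    (Metric.mem_ball_self (by positivity)) ?_ (by rwa [mem_ball_zero_iff, Real.norm_eq_abs])
  · intro p y hy
    rw [mem_ball_zero_iff, Real.norm_eq_abs] at hy
    simp only [triTerm, Pi.one_apply, one_mul]
    rw [norm_mul]
    gcongr
    exact symbolBound_zero.1 (symbolBound_approxSymbol hτ hy.le) _ _ _
  · simp only [primSymbol_zero, Pi.zero_apply, zero_mul]
    exact summable_zero

lemma seqNorm_I_smul (s : ℝ) (a : Freq d → ℂ) : seqNorm s (Complex.I • a) = seqNorm s a := by
  rw [seqNorm_smul, ← ofReal_norm, Complex.norm_I, ENNReal.ofReal_one, one_mul]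

/-- `v` is the family of Fourier coefficients of a solution on `[0, τ]` of the cubic Schrödinger
equation in the interaction picture, bounded by `M` in `H^{γ+2}`. -/
structure IsProfile (γ τ : ℝ) (M : ℝ≥0) (v : ℝ → Freq d → ℂ) : Prop where
  continuousOn : ContinuousOn v (Icc 0 τ)
  hasDerivAt : ∀ s ∈ Ioo 0 τ, ∀ ξ,
    HasDerivAt (fun s => v s ξ) (Complex.I * cubicMap (phaseSymbol s) (v s) ξ) s
  seqNorm_le : ∀ s ∈ Icc 0 τ, seqNorm (γ + 2) (v s) ≤ M

variable (d) in
/-- The constant in the bound `linConst d γ M * s ^ 2` of the second-order Taylor remainder of a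
profile. -/
def linConst (γ : ℝ) (M : ℝ≥0) : ℝ≥0 :=
  4 * triConst d γ * M ^ 3 + 3 * triConst d γ ^ 2 * M ^ 5

variable (d) in
/-- The constant in the bound `localConst d γ M * τ ^ 3` of the local error. -/
def localConst (γ : ℝ) (M : ℝ≥0) : ℝ≥0 :=
  48 * triConst d γ * M ^ 3 + 3 * triConst d γ * M ^ 2 * linConst d γ M
    + 12 * triConst d γ * M ^ 2 * (triConst d (γ + 2) * M ^ 3)
    + 3 * triConst d γ * M * (triConst d γ * M ^ 3) ^ 2

namespace IsProfile

lemma mono (h : IsProfile γ τ M v) (hs : s ≤ τ) : IsProfile γ s M v :=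
  ⟨h.continuousOn.mono (Icc_subset_Icc_right hs),
    fun r hr => h.hasDerivAt r ⟨hr.1, hr.2.trans_le hs⟩,
    fun r hr => h.seqNorm_le r ⟨hr.1, hr.2.trans hs⟩⟩

lemma seqNorm_le_of_mem (h : IsProfile γ τ M v) (hs : s ∈ Icc 0 τ) : seqNorm γ (v s) ≤ M :=
  (seqNorm_mono_exponent (by linarith) _).trans (h.seqNorm_le s hs)

lemma summable (h : IsProfile γ τ M v) (hγ : (d : ℝ) / 2 < γ) (hs : s ∈ Icc 0 τ) :
    Summable (v s) :=
  summable_of_seqNorm_ne_top hγ (ne_top_of_le_ne_top ENNReal.coe_ne_top (h.seqNorm_le_of_mem hs))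

lemma seqNorm_sub_zero_le (h : IsProfile γ τ M v) (hγ : (d : ℝ) / 2 < γ) (hs : s ∈ Icc 0 τ) :
    seqNorm γ (v s - v 0) ≤ triConst d γ * M ^ 3 * ENNReal.ofReal s := by
  have hs' := h.mono hs.2
  refine (seqNorm_sub_le_of_hasDerivAt (C := triConst d γ * M ^ 3) hs.1 hs'.continuousOn
    (a' := fun r => Complex.I • cubicMap (phaseSymbol r) (v r)) hs'.hasDerivAt
    fun r hr => ?_).trans_eq (by push_cast; rfl)
  have hr := seqNorm_cubicMap_le hγ (symbolBound_phaseSymbol r) (a := v r) (R := M)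
    (by rw [add_zero]; exact hs'.seqNorm_le_of_mem (Ioo_subset_Icc_self hr))
  rw [seqNorm_I_smul]
  push_cast
  simpa using hr

lemma seqNorm_cubicMap_sub_cubic_le (h : IsProfile γ τ M v) (hγ : (d : ℝ) / 2 < γ)
    (hs : s ∈ Icc 0 τ) :
    seqNorm γ (cubicMap (phaseSymbol s) (v s) - cubic (v 0))
      ≤ linConst d γ M * ENNReal.ofReal s := by
  have h0 : (0 : ℝ) ∈ Icc 0 τ := ⟨le_rfl, hs.1.trans hs.2⟩
  have hv := h.summable hγ hs
  have split : cubicMap (phaseSymbol s) (v s) - cubic (v 0)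
      = cubicMap (phaseSymbol s - 1) (v s) + (cubic (v s) - cubic (v 0)) := by
    simp only [cubic, cubicMap]
    rw [tri_sub_symbol (symbolBound_phaseSymbol s).isBoundedSymbol isBoundedSymbol_one
      (summable_cstar hv) hv hv]
    abel
  rw [split]
  calc seqNorm γ (cubicMap (phaseSymbol s - 1) (v s) + (cubic (v s) - cubic (v 0)))
      ≤ triConst d γ * (4 * ENNReal.ofReal s) * M ^ 3
          + 3 * triConst d γ * M ^ 2 * (triConst d γ * M ^ 3 * ENNReal.ofReal s) := by
        refine (seqNorm_add_le _ _ _).trans (add_le_add ?_ ?_)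
        · exact seqNorm_cubicMap_le hγ (symbolBound_phaseSymbol_sub_one hs.1) (h.seqNorm_le s hs)
        · refine (seqNorm_cubic_sub_le hγ (h.seqNorm_le_of_mem hs)
            (h.seqNorm_le_of_mem h0)).trans ?_
          gcongr
          exact h.seqNorm_sub_zero_le hγ hs
    _ = linConst d γ M * ENNReal.ofReal s := by rw [linConst]; push_cast; ring

lemma seqNorm_sub_linear_le (h : IsProfile γ τ M v) (hγ : (d : ℝ) / 2 < γ) (hs : s ∈ Icc 0 τ) :
    seqNorm γ (v s - v 0 - (Complex.I * s) • cubic (v 0))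
      ≤ linConst d γ M * ENNReal.ofReal s ^ 2 := by
  have hs' := h.mono hs.2
  have key := seqNorm_sub_le_of_hasDerivAt (s := γ) (C := linConst d γ M * s.toNNReal) hs.1
    (a := fun r => v r - (Complex.I * r) • cubic (v 0))
    (a' := fun r => Complex.I • (cubicMap (phaseSymbol r) (v r) - cubic (v 0)))
    (hs'.continuousOn.sub (by fun_prop)) ?_ ?_
  · calc seqNorm γ (v s - v 0 - (Complex.I * s) • cubic (v 0))
        = seqNorm γ (v s - (Complex.I * s) • cubic (v 0)
            - (v 0 - (Complex.I * (0 : ℝ)) • cubic (v 0))) := by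
          rw [Complex.ofReal_zero, mul_zero, zero_smul, sub_zero, sub_right_comm]
      _ ≤ (linConst d γ M * s.toNNReal : ℝ≥0) * ENNReal.ofReal s := key
      _ = linConst d γ M * ENNReal.ofReal s ^ 2 := by
          rw [sq, ← mul_assoc, ENNReal.coe_mul, ENNReal.ofReal]
  · intro r hr ξ
    refine ((hs'.hasDerivAt r hr ξ).sub ((((hasDerivAt_id r).ofReal_comp).const_mul
      Complex.I).mul_const (cubic (v 0) ξ))).congr_deriv ?_
    simp only [Pi.smul_apply, Pi.sub_apply, smul_eq_mul, Complex.ofReal_one]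
    ring
  · intro r hr
    rw [seqNorm_I_smul]
    refine (hs'.seqNorm_cubicMap_sub_cubic_le hγ (Ioo_subset_Icc_self hr)).trans ?_
    rw [ENNReal.coe_mul]
    gcongr
    exact ENNReal.ofReal_le_ofReal hr.2.le

lemma seqNorm_defect_le (h : IsProfile γ τ M v) (hγ : (d : ℝ) / 2 < γ) (hτ : 0 < τ)
    (hs : s ∈ Icc 0 τ) :
    seqNorm γ (cubicMap (phaseSymbol s) (v s) - cubicMap (approxSymbol τ s) (v 0)
        - (Complex.I * s) • quintic (v 0)) ≤ localConst d γ M * ENNReal.ofReal τ ^ 2 := by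
  have h0 : (0 : ℝ) ∈ Icc 0 τ := ⟨le_rfl, hτ.le⟩
  have hp : seqNorm (γ + 2) ((Complex.I * s) • cubic (v 0))
      ≤ (s.toNNReal * (triConst d (γ + 2) * M ^ 3) : ℝ≥0) := by
    rw [mul_smul, seqNorm_I_smul, seqNorm_smul, ← ofReal_norm, Complex.norm_of_nonneg hs.1]
    push_cast
    exact mul_le_mul_right (seqNorm_cubic_le (by linarith) (h.seqNorm_le 0 h0)) _
  have happrox : SymbolBound 0 5 (approxSymbol τ s : Symbol (Freq d)) :=
    symbolBound_approxSymbol hτ (by rw [abs_of_nonneg hs.1]; linarith [hs.2])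
  have expansion := seqNorm_cubicMap_add_sub_le hγ (symbolBound_phaseSymbol s)
    happrox.isBoundedSymbol (symbolBound_phaseSymbol_sub_one hs.1)
    (symbolBound_phaseSymbol_sub_approxSymbol hτ hs.1 hs.2) zero_le_two (h.seqNorm_le 0 h0)
    ((add_sub_cancel (v 0) (v s)).symm ▸ h.seqNorm_le_of_mem hs)
    (h.seqNorm_sub_zero_le hγ hs) hp (h.seqNorm_sub_linear_le hγ hs)
  rw [add_sub_cancel, triLin_I_smul_cubic s (h.summable hγ h0)] at expansion
  have hsτ : s.toNNReal ≤ τ.toNNReal := Real.toNNReal_le_toNNReal hs.2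
  refine expansion.trans ?_
  simp only [ENNReal.ofReal, localConst]
  norm_cast
  generalize s.toNNReal = s at hsτ ⊢
  generalize τ.toNNReal = τ at hsτ ⊢
  calc _ = 48 * triConst d γ * M ^ 3 * τ ^ 2
          + (3 * triConst d γ * M ^ 2 * linConst d γ M
            + 12 * triConst d γ * M ^ 2 * (triConst d (γ + 2) * M ^ 3)
            + 3 * triConst d γ * M * (triConst d γ * M ^ 3) ^ 2) * s ^ 2 := by ring
    _ ≤ 48 * triConst d γ * M ^ 3 * τ ^ 2
          + (3 * triConst d γ * M ^ 2 * linConst d γ M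
            + 12 * triConst d γ * M ^ 2 * (triConst d (γ + 2) * M ^ 3)
            + 3 * triConst d γ * M * (triConst d γ * M ^ 3) ^ 2) * τ ^ 2 := by gcongr
    _ = _ := by ring

lemma seqNorm_localError_le (h : IsProfile γ τ M v) (hγ : (d : ℝ) / 2 < γ) (hτ : 0 < τ) :
    seqNorm γ (v τ - stepSeq τ (v 0)) ≤ localConst d γ M * ENNReal.ofReal τ ^ 3 := by
  have hw := h.summable hγ ⟨le_rfl, hτ.le⟩
  let step (s : ℝ) : Freq d → ℂ :=
    v 0 + Complex.I • cubicMap (primSymbol τ s) (v 0) - ((s : ℂ) ^ 2 / 2) • quintic (v 0)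
  have step_zero : step 0 = v 0 := by
    ext ξ; simp [step, primSymbol_zero, cubicMap, tri, triTerm]
  have hstep (s : ℝ) (hs : s ∈ Icc 0 τ) (ξ : Freq d) : HasDerivAt (fun s => step s ξ)
      (Complex.I * cubicMap (approxSymbol τ s) (v 0) ξ - s * quintic (v 0) ξ) s := by
    have hcubic := hasDerivAt_tri_primSymbol hτ (s := s)
      (by rw [abs_of_nonneg hs.1]; linarith [hs.2]) (summable_cstar hw) hw hw ξ
    have hquintic := ((((hasDerivAt_id s).ofReal_comp).pow 2).div_const 2).mul_const
      (quintic (v 0) ξ)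
    refine (((hcubic.const_mul Complex.I).const_add (v 0 ξ)).sub hquintic).congr_deriv ?_
    simp [cubicMap]
  have key := seqNorm_sub_le_of_hasDerivAt (s := γ) (C := localConst d γ M * τ.toNNReal ^ 2) hτ.le
    (a := fun s => v s - step s)
    (a' := fun s => Complex.I • (cubicMap (phaseSymbol s) (v s)
      - cubicMap (approxSymbol τ s) (v 0) - (Complex.I * s) • quintic (v 0)))
    (h.continuousOn.sub (continuousOn_pi.2 fun ξ s hs =>
      (hstep s hs ξ).continuousAt.continuousWithinAt)) ?_ ?_
  · simp only [step_zero, sub_self, sub_zero] at key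
    refine key.trans_eq ?_
    rw [ENNReal.coe_mul, ENNReal.coe_pow, mul_assoc, ENNReal.ofReal, ← pow_succ]
  · intro s hs ξ
    refine ((h.hasDerivAt s hs ξ).sub (hstep s (Ioo_subset_Icc_self hs) ξ)).congr_deriv ?_
    simp only [Pi.smul_apply, Pi.sub_apply, smul_eq_mul]
    linear_combination ((s : ℂ) * quintic (v 0) ξ) * Complex.I_mul_I
  · intro s hs
    rw [seqNorm_I_smul, ENNReal.coe_mul, ENNReal.coe_pow]
    exact h.seqNorm_defect_le hγ hτ (Ioo_subset_Icc_self hs)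

end IsProfile

end LocalError

/-! ### Stability -/

section Stability

variable {d : ℕ} {γ : ℝ} {R : ℝ≥0} {a b : Freq d → ℂ}

variable (d) in
/-- The Lipschitz constant of the nonlinear part of the integrator on a ball of radius `R`, per
unit of time. -/
def stabConst (γ : ℝ) (R : ℝ≥0) : ℝ≥0 :=
  15 * triConst d γ * R ^ 2
    + 3 * triConst d γ * (R + triConst d γ * R ^ 3) ^ 2 * (1 + 3 * triConst d γ * R ^ 2)

lemma seqNorm_quintic_sub_le (hγ : (d : ℝ) / 2 < γ) (ha : seqNorm γ a ≤ R)
    (hb : seqNorm γ b ≤ R) :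
    seqNorm γ (quintic a - quintic b) ≤ 3 * triConst d γ * (R + triConst d γ * R ^ 3) ^ 2
      * (1 + 3 * triConst d γ * R ^ 2) * seqNorm γ (a - b) := by
  have hradius {x : Freq d → ℂ} (hx : seqNorm γ x ≤ R) :
      seqNorm γ x ≤ (R + triConst d γ * R ^ 3 : ℝ≥0) := hx.trans (by push_cast; exact le_self_add)
  have hradius_cubic {x : Freq d → ℂ} (hx : seqNorm γ x ≤ R) :
      seqNorm γ (cubic x) ≤ (R + triConst d γ * R ^ 3 : ℝ≥0) :=
    (seqNorm_cubic_le hγ hx).trans (by push_cast; exact le_add_self)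
  have hsub : seqNorm γ (a - b) ≤ (1 + 3 * triConst d γ * R ^ 2) * seqNorm γ (a - b) := by
    rw [add_mul, one_mul]; exact le_self_add
  have hsub_cubic : seqNorm γ (cubic a - cubic b)
      ≤ (1 + 3 * triConst d γ * R ^ 2) * seqNorm γ (a - b) :=
    (seqNorm_cubic_sub_le hγ ha hb).trans (by gcongr; exact le_add_self)
  refine (seqNorm_tri_sub_tri_le hγ symbolBound_one ((seqNorm_cstar γ a).trans_le (hradius ha))
    (hradius_cubic ha) (hradius ha) ((seqNorm_cstar γ b).trans_le (hradius hb))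
    (hradius_cubic hb) (hradius hb) ?_ hsub_cubic hsub).trans_eq (by push_cast; ring)
  rwa [← cstar_sub, seqNorm_cstar]

lemma seqNorm_stepSeq_sub_le (hγ : (d : ℝ) / 2 < γ) {τ : ℝ} (hτ : 0 < τ) (hτ1 : τ ≤ 1)
    (ha : seqNorm γ a ≤ R) (hb : seqNorm γ b ≤ R) :
    seqNorm γ (stepSeq τ a - stepSeq τ b)
      ≤ (1 + stabConst d γ R * ENNReal.ofReal τ) * seqNorm γ (a - b) := by
  have hcubic := seqNorm_cubicMap_sub_le hγ (symbolBound_primSymbol hτ) ha hb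
  have hquintic := seqNorm_quintic_sub_le hγ ha hb
  have split : stepSeq τ a - stepSeq τ b = (a - b)
      + Complex.I • (cubicMap (primSymbol τ τ) a - cubicMap (primSymbol τ τ) b)
      - ((τ : ℂ) ^ 2 / 2) • (quintic a - quintic b) := by
    rw [stepSeq, stepSeq]; module
  have hcoeff : ‖((τ : ℂ) ^ 2 / 2)‖ₑ ≤ ENNReal.ofReal τ := by
    rw [← ofReal_norm, norm_div, norm_pow, Complex.norm_of_nonneg hτ.le, Complex.norm_ofNat]
    exact ENNReal.ofReal_le_ofReal (by nlinarith)
  rw [split]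
  calc seqNorm γ ((a - b) + Complex.I • (cubicMap (primSymbol τ τ) a - cubicMap (primSymbol τ τ) b)
          - ((τ : ℂ) ^ 2 / 2) • (quintic a - quintic b))
      ≤ seqNorm γ (a - b)
          + 3 * triConst d γ * (5 * τ.toNNReal : ℝ≥0) * R ^ 2 * seqNorm γ (a - b)
          + ENNReal.ofReal τ * (3 * triConst d γ * (R + triConst d γ * R ^ 3) ^ 2
            * (1 + 3 * triConst d γ * R ^ 2) * seqNorm γ (a - b)) := by
        refine (seqNorm_sub_le _ _ _).trans (add_le_add ((seqNorm_add_le _ _ _).trans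
          (add_le_add le_rfl ?_)) ?_)
        · rwa [seqNorm_I_smul]
        · rw [seqNorm_smul]; gcongr
    _ = (1 + stabConst d γ R * ENNReal.ofReal τ) * seqNorm γ (a - b) := by
        simp only [stabConst, ENNReal.ofReal]; push_cast; ring

end Stability

/-! ### The Fourier coefficients of the integrator -/

section Coefficients

open Complex

variable {d : ℕ}

/-- The Fourier multiplier `e^{-iτ|ξ|²}` of the free propagator `e^{iτΔ}`. -/
def freePhase (τ : ℝ) (ξ : Freq d) : ℂ := exp (I * (-(τ * freqSq ξ) : ℝ))

/-- The Fourier multiplier `φ(2iτ|ξ|²)` of `φ(-2iτΔ)`. -/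
def phiMul (τ : ℝ) (ξ : Freq d) : ℂ := phi (2 * I * τ * freqSq ξ)

/-- The Fourier multiplier `ψ(2iτ|ξ|²)` of `ψ(-2iτΔ)`. -/
def psiMul (τ : ℝ) (ξ : Freq d) : ℂ := psi (2 * I * τ * freqSq ξ)

lemma norm_freePhase (τ : ℝ) (ξ : Freq d) : ‖freePhase τ ξ‖ = 1 := norm_exp_I_mul _

lemma freePhase_zero : freePhase 0 = (1 : Freq d → ℂ) := by ext ξ; simp [freePhase]

lemma freePhase_add (s t : ℝ) : freePhase (s + t) = (freePhase s * freePhase t : Freq d → ℂ) := by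
  ext ξ
  rw [Pi.mul_apply, freePhase, freePhase, freePhase, ← Complex.exp_add]
  congr 1
  push_cast
  ring

lemma freePhase_mul_freePhase_neg (τ : ℝ) :
    freePhase τ * freePhase (-τ) = (1 : Freq d → ℂ) := by
  rw [← freePhase_add, add_neg_cancel, freePhase_zero]

lemma norm_phiMul_le (τ : ℝ) (ξ : Freq d) : ‖phiMul τ ξ‖ ≤ 1 := by
  simpa [phiMul, mul_assoc] using norm_phi_le (τ * freqSq ξ)

lemma norm_psiMul_le (τ : ℝ) (ξ : Freq d) : ‖psiMul τ ξ‖ ≤ 1 := by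
  simpa [psiMul, mul_assoc] using norm_psi_le (τ * freqSq ξ)

lemma norm_phiMul_add_psiMul_le (τ : ℝ) (ξ : Freq d) :
    ‖(phiMul τ + psiMul τ : Freq d → ℂ) ξ‖ ≤ 2 :=
  (norm_add_le _ _).trans (by linarith [norm_phiMul_le τ ξ, norm_psiMul_le τ ξ])

lemma coeff_propagator (τ : ℝ) (f : L2 d) :
    coeff (propagator τ f) = freePhase τ * coeff f := by
  rw [propagator, coeff_funLaplacian (B := 1)]
  · congr 1; ext ξ; rw [freePhase]; congr 1; push_cast; ring
  · intro x
    rw [show I * τ * -(x : ℂ) = I * ((-(τ * x) : ℝ) : ℂ) by push_cast; ring]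
    exact (norm_exp_I_mul _).le

lemma coeff_phiOp (τ : ℝ) (f : L2 d) : coeff (phiOp τ f) = phiMul τ * coeff f := by
  rw [phiOp, coeff_funLaplacian (B := 1)]
  · congr 1; ext ξ; rw [phiMul]; congr 1; ring
  · intro x
    rw [show -2 * I * τ * -(x : ℂ) = 2 * I * ((τ * x : ℝ) : ℂ) by push_cast; ring]
    exact norm_phi_le _

lemma coeff_psiOp (τ : ℝ) (f : L2 d) : coeff (psiOp τ f) = psiMul τ * coeff f := by
  rw [psiOp, coeff_funLaplacian (B := 1)]
  · congr 1; ext ξ; rw [psiMul]; congr 1; ring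
  · intro x
    rw [show -2 * I * τ * -(x : ℂ) = 2 * I * ((τ * x : ℝ) : ℂ) by push_cast; ring]
    exact norm_psi_le _

lemma summable_mul_of_norm_le {α : Type*} {B : ℝ} {k a : α → ℂ} (hk : ∀ x, ‖k x‖ ≤ B)
    (ha : Summable a) : Summable (k * a) :=
  Summable.of_norm_bounded (ha.norm.mul_left B) fun x => by
    rw [Pi.mul_apply, norm_mul]; gcongr; exact hk x

lemma summable_freePhase_mul (τ : ℝ) {a : Freq d → ℂ} (ha : Summable a) :
    Summable (freePhase τ * a) := summable_mul_of_norm_le (fun ξ => (norm_freePhase τ ξ).le) ha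

lemma primSymbol_self {τ : ℝ} (hτ : τ ≠ 0) (ξ η ζ : Freq d) :
    primSymbol τ τ ξ η ζ = τ * (phiMul τ ξ + psiMul τ ξ)
      - τ * (psiMul τ ξ * exp (I * (τ * beta ξ η ζ : ℝ))) := by
  have : (τ : ℂ) ≠ 0 := by exact_mod_cast hτ
  rw [primSymbol, phiMul, psiMul]
  field_simp
  ring

lemma exp_I_mul_beta (τ : ℝ) (ξ η ζ : Freq d) :
    exp (I * (τ * beta ξ η ζ : ℝ))
      = freePhase (-τ) (ξ + η + ζ) * (freePhase τ ξ * freePhase τ η * freePhase τ ζ) := by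
  simp only [freePhase, ← Complex.exp_add, beta]
  congr 1
  push_cast
  ring

lemma tri_primSymbol_self {τ : ℝ} (hτ : τ ≠ 0) {a b c : Freq d → ℂ} (ha : Summable a)
    (hb : Summable b) (hc : Summable c) :
    tri (primSymbol τ τ) a b c = (τ : ℂ) • tri 1 ((phiMul τ + psiMul τ) * a) b c
      - (τ : ℂ) • (freePhase (-τ) *
          tri 1 (freePhase τ * (psiMul τ * a)) (freePhase τ * b) (freePhase τ * c)) := by
  ext ξ
  have hfst := summable_triTerm isBoundedSymbol_one
    (summable_mul_of_norm_le (norm_phiMul_add_psiMul_le τ) ha) hb hc ξ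
  have hsnd := summable_triTerm isBoundedSymbol_one
    (summable_freePhase_mul τ (summable_mul_of_norm_le (norm_psiMul_le τ) ha))
    (summable_freePhase_mul τ hb) (summable_freePhase_mul τ hc) ξ
  simp only [Pi.sub_apply, Pi.smul_apply, Pi.mul_apply, smul_eq_mul, tri, ← tsum_mul_left]
  rw [← (hfst.mul_left _).tsum_sub ((hsnd.mul_left _).mul_left _)]
  refine tsum_congr fun p => ?_
  simp only [triTerm, primSymbol_self hτ, exp_I_mul_beta,
    show p.1 + p.2 + (ξ - p.1 - p.2) = ξ by abel, Pi.mul_apply, Pi.add_apply, Pi.one_apply]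
  ring

lemma HasFourier.of_coeff_eq {f : L2 d} {a : Freq d → ℂ} (h : coeff f = a) (ha : Summable a) :
    HasFourier f a := by
  subst h; exact HasFourier.of_summable_coeff ha

section Step

variable {w : L2 d} (hw : Summable (coeff w))

include hw

lemma coeff_conjL2 : coeff (conjL2 w) = cstar (coeff w) :=
  (HasFourier.of_summable_coeff hw).conjugate.coeff_toL2

lemma coeff_toL2_phiOp_add_psiOp_mul_sq (τ : ℝ) :
    coeff (toL2 fun x => (phiOp τ (conjL2 w) + psiOp τ (conjL2 w) : L2 d) x * w x ^ 2)
      = tri 1 ((phiMul τ + psiMul τ) * cstar (coeff w)) (coeff w) (coeff w) := by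
  have hF := HasFourier.of_summable_coeff hw
  have hsum : HasFourier (phiOp τ (conjL2 w) + psiOp τ (conjL2 w) : L2 d)
      ((phiMul τ + psiMul τ) * cstar (coeff w)) :=
    .of_coeff_eq (by rw [coeff_add, coeff_phiOp, coeff_psiOp, coeff_conjL2 hw, add_mul])
      (summable_mul_of_norm_le (norm_phiMul_add_psiMul_le τ) (summable_cstar hw))
  exact ((hsum.mul_mul hF hF).congr (.of_forall fun x => by ring)).coeff_toL2

lemma coeff_toL2_propagator_psiOp_mul_sq (τ : ℝ) :
    coeff (toL2 fun x => propagator τ (psiOp τ (conjL2 w)) x * propagator τ w x ^ 2)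
      = tri 1 (freePhase τ * (psiMul τ * cstar (coeff w))) (freePhase τ * coeff w)
          (freePhase τ * coeff w) := by
  have hpsi : HasFourier (propagator τ (psiOp τ (conjL2 w)))
      (freePhase τ * (psiMul τ * cstar (coeff w))) :=
    .of_coeff_eq (by rw [coeff_propagator, coeff_psiOp, coeff_conjL2 hw])
      (summable_freePhase_mul τ (summable_mul_of_norm_le (norm_psiMul_le τ) (summable_cstar hw)))
  have hprop : HasFourier (propagator τ w) (freePhase τ * coeff w) :=
    .of_coeff_eq (coeff_propagator τ w) (summable_freePhase_mul τ hw)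
  exact ((hpsi.mul_mul hprop hprop).congr (.of_forall fun x => by ring)).coeff_toL2

lemma coeff_toL2_norm_pow_four_mul :
    coeff (toL2 fun x => (‖w x‖ : ℂ) ^ 4 * w x) = quintic (coeff w) := by
  have hF := HasFourier.of_summable_coeff hw
  refine ((hF.conjugate.mul_mul hF.cubic hF).congr (.of_forall fun x => ?_)).coeff_toL2
  rw [show (‖w x‖ : ℂ) ^ 4 = ((‖w x‖ : ℂ) ^ 2) ^ 2 by ring, ← Complex.conj_mul']
  ring

lemma coeff_lriStep {τ : ℝ} (hτ : τ ≠ 0) :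
    coeff (lriStep τ w) = freePhase τ * stepSeq τ (coeff w) := by
  rw [lriStep, coeff_sub, coeff_sub, coeff_add, coeff_smul, coeff_smul, coeff_smul,
    coeff_propagator, coeff_propagator, coeff_propagator,
    coeff_toL2_phiOp_add_psiOp_mul_sq hw, coeff_toL2_propagator_psiOp_mul_sq hw,
    coeff_toL2_norm_pow_four_mul hw, stepSeq, cubicMap,
    tri_primSymbol_self hτ (summable_cstar hw) hw hw]
  ext ξ
  have hcancel := congrFun (freePhase_mul_freePhase_neg τ) ξ
  simp only [Pi.sub_apply, Pi.add_apply, Pi.smul_apply, Pi.mul_apply, Pi.one_apply,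
    smul_eq_mul] at hcancel ⊢
  linear_combination (I * τ * tri 1 (freePhase τ * (psiMul τ * cstar (coeff w)))
    (freePhase τ * coeff w) (freePhase τ * coeff w) ξ) * hcancel

end Step

end Coefficients

/-! ### The interaction picture -/

section InteractionPicture

open Complex Set

variable {d : ℕ} {γ T t τ : ℝ} {M : ℝ≥0} {u₀ w : L2 d} {u : ℝ → L2 d}

lemma cstar_freePhase_mul (s : ℝ) (a : Freq d → ℂ) :
    cstar (freePhase s * a) = freePhase (-s) * cstar a := by
  ext ξ
  simp only [cstar, freePhase, Pi.mul_apply, map_mul, ← exp_conj, conj_I, conj_ofReal, freqSq_neg]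
  congr 2
  push_cast
  ring

lemma phaseSymbol_eq_freePhase (s : ℝ) :
    (phaseSymbol s : Symbol (Freq d)) = fun ξ η ζ => freePhase (-s) (ξ + η + ζ)
      * (freePhase (-s) ξ * freePhase s η * freePhase s ζ) * (1 : Symbol (Freq d)) ξ η ζ := by
  ext ξ η ζ
  simp only [phaseSymbol, freePhase, ← Complex.exp_add, alpha, beta, Pi.one_apply, mul_one]
  congr 1
  push_cast
  ring

lemma cubicMap_phaseSymbol (s : ℝ) (a : Freq d → ℂ) :
    cubicMap (phaseSymbol s) (freePhase (-s) * a) = freePhase (-s) * cubic a := by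
  have hcancel := freePhase_mul_freePhase_neg (d := d) s
  rw [phaseSymbol_eq_freePhase, cubicMap, tri_multiplier, cstar_freePhase_mul, neg_neg, cubic,
    cubicMap, ← mul_assoc, ← mul_assoc, mul_comm (freePhase (-s)) (freePhase s), hcancel, one_mul,
    one_mul]

lemma hasDerivAt_freePhase_neg (s : ℝ) (ξ : Freq d) :
    HasDerivAt (fun s => freePhase (-s) ξ) (freePhase (-s) ξ * (I * freqSq ξ)) s := by
  have hphase := ((hasDerivAt_mul_const (x := s) (freqSq ξ)).ofReal_comp.const_mul I).cexp
  simpa only [freePhase, neg_mul, neg_neg] using hphase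

lemma seqNorm_freePhase_mul (s τ : ℝ) (a : Freq d → ℂ) :
    seqNorm s (freePhase τ * a) = seqNorm s a :=
  seqNorm_congr fun ξ => by
    rw [Pi.mul_apply, enorm_mul, ← ofReal_norm, norm_freePhase, ENNReal.ofReal_one, one_mul]

lemma coeff_norm_sq_mul (hw : Summable (coeff w)) :
    coeff (fun x => (‖w x‖ : ℂ) ^ 2 * w x) = cubic (coeff w) :=
  ((HasFourier.of_summable_coeff hw).cubic.congr
    (.of_forall fun x => congrArg (· * w x) (Complex.conj_mul' (w x)))).coeff_eq

lemma isProfile_of_isSolution (hγ : (d : ℝ) / 2 < γ) (hu : IsSolution T u₀ u)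
    (hM : ∀ t ∈ Icc 0 T, seqNorm (γ + 2) (coeff (u t)) ≤ M) (ht : 0 ≤ t) (htτ : t + τ ≤ T) :
    IsProfile γ τ M fun s => freePhase (-s) * coeff (u (t + s)) := by
  have hmem : MapsTo (t + ·) (Icc 0 τ) (Icc 0 T) := fun s hs =>
    ⟨add_nonneg ht hs.1, (by linarith [hs.2] : t + s ≤ T)⟩
  refine ⟨continuousOn_pi.2 fun ξ => ?_, fun s hs ξ => ?_, fun s hs => ?_⟩
  · exact (continuous_iff_continuousAt.2 fun s =>
      (hasDerivAt_freePhase_neg s ξ).continuousAt).continuousOn.mul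
      ((continuous_coeff ξ).comp_continuousOn (hu.continuousOn.comp (by fun_prop) hmem))
  · have hts : t + s ∈ Ioo 0 T := ⟨by linarith [hs.1], by linarith [hs.2]⟩
    obtain ⟨v, hv, heq⟩ := hu.equation (t + s) hts ξ
    have hsum : Summable (coeff (u (t + s))) := summable_of_seqNorm_ne_top hγ
      (ne_top_of_le_ne_top ENNReal.coe_ne_top ((seqNorm_mono_exponent (by linarith) _).trans
        (hM _ (Ioo_subset_Icc_self hts))))
    have hv_eq : v = -I * freqSq ξ * coeff (u (t + s)) ξ + I * cubic (coeff (u (t + s))) ξ := by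
      rw [coeff_norm_sq_mul hsum] at heq
      linear_combination (-I) * heq + v * I_mul_I
    refine ((hasDerivAt_freePhase_neg s ξ).mul (hv.comp_const_add t s)).congr_deriv ?_
    rw [cubicMap_phaseSymbol, hv_eq, Pi.mul_apply]
    ring
  · rw [seqNorm_freePhase_mul]
    exact hM _ (hmem hs)

lemma seqNorm_error_succ_le (hγ : (d : ℝ) / 2 < γ) (hu : IsSolution T u₀ u)
    (hM : ∀ t ∈ Icc 0 T, seqNorm (γ + 2) (coeff (u t)) ≤ M) (ht : 0 ≤ t) (hτ : 0 < τ)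
    (hτ1 : τ ≤ 1) (htτ : t + τ ≤ T) (hw : seqNorm γ (coeff (u t) - coeff w) ≤ 1) :
    seqNorm γ (coeff (u (t + τ)) - coeff (lriStep τ w))
      ≤ localConst d γ M * ENNReal.ofReal τ ^ 3
        + (1 + stabConst d γ (M + 1) * ENNReal.ofReal τ) * seqNorm γ (coeff (u t) - coeff w) := by
  have hut : seqNorm γ (coeff (u t)) ≤ M :=
    (seqNorm_mono_exponent (by linarith) _).trans (hM t ⟨ht, by linarith⟩)
  have hwM : seqNorm γ (coeff w) ≤ (M + 1 : ℝ≥0) := by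
    rw [← sub_sub_cancel (coeff (u t)) (coeff (w : Torus d → ℂ))]
    exact (seqNorm_sub_le _ _ _).trans (by push_cast; exact add_le_add hut hw)
  have hlocal := (isProfile_of_isSolution hγ hu hM ht htτ).seqNorm_localError_le hγ hτ
  simp only [neg_zero, freePhase_zero, one_mul, add_zero] at hlocal
  have hstab := seqNorm_stepSeq_sub_le hγ hτ hτ1 (R := M + 1)
    (hut.trans (by push_cast; exact le_self_add)) hwM
  have hsplit : freePhase (-τ) * (coeff (u (t + τ)) - coeff (lriStep τ w))
      = (freePhase (-τ) * coeff (u (t + τ)) - stepSeq τ (coeff (u t)))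
        + (stepSeq τ (coeff (u t)) - stepSeq τ (coeff w)) := by
    rw [coeff_lriStep (summable_of_seqNorm_ne_top hγ
      (ne_top_of_le_ne_top ENNReal.coe_ne_top hwM)) hτ.ne', mul_sub, ← mul_assoc,
      mul_comm (freePhase (-τ)) (freePhase τ), freePhase_mul_freePhase_neg, one_mul,
      sub_add_sub_cancel]
  rw [← seqNorm_freePhase_mul γ (-τ), hsplit]
  exact (seqNorm_add_le _ _ _).trans (add_le_add hlocal hstab)

end InteractionPicture

/-! ### The global error -/

section GlobalError

variable {d : ℕ} {γ T τ : ℝ} {M A L : ℝ≥0} {u₀ : L2 d} {u : ℝ → L2 d}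

/-- The constant in the discrete Gronwall bound at time `T`, for local errors `A * τ ^ (p + 1)` and
growth factors `1 + L * τ`. -/
def gronwallConst (A L : ℝ≥0) (T : ℝ) : ℝ := A * T * Real.exp (L * T)

lemma gronwallConst_nonneg (hT : 0 ≤ T) : 0 ≤ gronwallConst A L T := by
  unfold gronwallConst; positivity

lemma mul_one_add_pow_le_gronwallConst (hτ : 0 < τ) (p : ℕ) {n : ℕ} (hn : n * τ ≤ T) :
    A * ENNReal.ofReal τ ^ (p + 1) * n * (1 + L * ENNReal.ofReal τ) ^ n
      ≤ ENNReal.ofReal (gronwallConst A L T * τ ^ p) := by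
  lift τ to ℝ≥0 using hτ.le
  have hT : 0 ≤ T := le_trans (by positivity) hn
  have hexp : (1 + L * τ : ℝ) ^ n ≤ Real.exp (L * T) :=
    calc (1 + L * τ : ℝ) ^ n ≤ Real.exp (L * τ) ^ n := by
          gcongr; rw [add_comm]; exact Real.add_one_le_exp _
      _ = Real.exp (L * (n * τ)) := by rw [← Real.exp_nat_mul]; ring_nf
      _ ≤ Real.exp (L * T) := by gcongr
  have hreal : (A * τ ^ (p + 1) * n * (1 + L * τ) ^ n : ℝ) ≤ gronwallConst A L T * τ ^ p :=
    calc (A * τ ^ (p + 1) * n * (1 + L * τ) ^ n : ℝ)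
        = A * (n * τ) * (1 + L * τ) ^ n * τ ^ p := by ring
      _ ≤ A * T * Real.exp (L * T) * τ ^ p := by gcongr
  refine le_trans (le_of_eq ?_) (ENNReal.ofReal_le_ofReal hreal)
  rw [ENNReal.ofReal_coe_nnreal]
  exact_mod_cast
    (ENNReal.ofReal_coe_nnreal (p := A * τ ^ (p + 1) * n * (1 + L * τ) ^ n)).symm

/-- The recursion is only available while the error is at most `1`; the bound it produces is itself
at most `1`, which closes the induction. -/
lemma le_gronwallConst_of_le_one {e : ℕ → ℝ≥0∞} (hτ : 0 < τ) (p : ℕ) (he : e 0 = 0)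
    (hstep : ∀ n : ℕ, n * τ + τ ≤ T → e n ≤ 1 →
      e (n + 1) ≤ A * ENNReal.ofReal τ ^ (p + 1) + (1 + L * ENNReal.ofReal τ) * e n)
    (hsmall : gronwallConst A L T * τ ^ p ≤ 1) {n : ℕ} (hn : n * τ ≤ T) :
    e n ≤ ENNReal.ofReal (gronwallConst A L T * τ ^ p) := by
  set α : ℝ≥0∞ := A * ENNReal.ofReal τ ^ (p + 1)
  set β : ℝ≥0∞ := 1 + L * ENNReal.ofReal τ
  have hbound {n : ℕ} (hn : n * τ ≤ T) :
      α * n * β ^ n ≤ ENNReal.ofReal (gronwallConst A L T * τ ^ p) :=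
    mul_one_add_pow_le_gronwallConst hτ p hn
  suffices h : e n ≤ α * n * β ^ n from h.trans (hbound hn)
  induction n with
  | zero => simp [he]
  | succ n ih =>
    rw [Nat.cast_succ, add_one_mul] at hn
    have hn' : n * τ ≤ T := by linarith
    have hone : e n ≤ 1 :=
      (ih hn').trans ((hbound hn').trans (ENNReal.ofReal_le_one.2 hsmall))
    have hβ : 1 ≤ β ^ (n + 1) := one_le_pow₀ le_self_add
    calc e (n + 1) ≤ α + β * e n := hstep n hn hone
      _ ≤ α * β ^ (n + 1) + β * (α * n * β ^ n) :=
          add_le_add (le_mul_of_one_le_right' hβ) (by gcongr; exact ih hn')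
      _ = α * (n + 1 : ℕ) * β ^ (n + 1) := by push_cast; ring

lemma seqNorm_error_le (hγ : (d : ℝ) / 2 < γ) (hu : IsSolution T u₀ u)
    (hM : ∀ t ∈ Set.Icc 0 T, seqNorm (γ + 2) (coeff (u t)) ≤ M) (hτ : 0 < τ) (hτ1 : τ ≤ 1)
    (hsmall : gronwallConst (localConst d γ M) (stabConst d γ (M + 1)) T * τ ^ 2 ≤ 1) {n : ℕ}
    (hn : n * τ ≤ T) :
    seqNorm γ (coeff (u (n * τ)) - coeff (lri τ u₀ n))
      ≤ ENNReal.ofReal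
        (gronwallConst (localConst d γ M) (stabConst d γ (M + 1)) T * τ ^ 2) := by
  refine le_gronwallConst_of_le_one
    (e := fun n => seqNorm γ (coeff (u (n * τ)) - coeff (lri τ u₀ n))) hτ 2 ?_ ?_ hsmall hn
  · simp only [Nat.cast_zero, zero_mul, hu.initial, lri, sub_self, seqNorm_zero]
  · intro n hn hone
    rw [Nat.cast_succ, add_one_mul, lri]
    exact seqNorm_error_succ_le hγ hu hM (by positivity) hτ hτ1 hn hone

end GlobalError

end CubicNLS

end

theorem theorem1 (d : ℕ) (hd : 1 ≤ d) (γ : ℝ) (hγ : (d : ℝ) / 2 < γ) (T : ℝ) (hT : 0 < T)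
    (M : ℝ≥0) :
    ∃ τ₀ : ℝ, 0 < τ₀ ∧ ∃ C : ℝ, 0 < C ∧
      ∀ (u₀ : CubicNLS.L2 d) (u : ℝ → CubicNLS.L2 d),
        u₀ ∈ CubicNLS.sobolev d (γ + 2) →
        CubicNLS.IsSolution T u₀ u →
        CubicNLS.supSobolevNorm (γ + 2) T u ≤ (M : ℝ≥0∞) →
        ∀ τ : ℝ, 0 < τ → τ ≤ τ₀ → ∀ n : ℕ, (n : ℝ) * τ ≤ T →
          CubicNLS.sobolevNorm γ (u (n * τ) - CubicNLS.lri τ u₀ n) ≤ ENNReal.ofReal (C * τ ^ 2) := by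
  open CubicNLS in
  have hc := sobolevFactor_pos (d := d)
  set N : ℝ≥0 := M / (sobolevFactor d).toNNReal
  have hN_coe : (M : ℝ≥0∞) / ENNReal.ofReal (sobolevFactor d) = N :=
    (ENNReal.coe_div (Real.toNNReal_pos.2 hc).ne').symm
  set X := gronwallConst (localConst d γ N) (stabConst d γ (N + 1)) T
  have hX : 0 ≤ X := gronwallConst_nonneg hT.le
  refine ⟨1 / (X + 1), by positivity, sobolevFactor d * X + 1, by positivity,
    fun u₀ u _ hu hsup τ hτ hτ₀ n hn => ?_⟩
  have hXτ : τ * (X + 1) ≤ 1 := (le_div_iff₀ (by positivity)).1 hτ₀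
  have hτ1 : τ ≤ 1 := by nlinarith
  have hbound (t) (ht : t ∈ Set.Icc 0 T) : seqNorm (γ + 2) (coeff (u t)) ≤ N :=
    hN_coe ▸ seqNorm_coeff_le_of_supSobolevNorm_le hT hu.continuousOn hsup ht
  rw [sobolevNorm_eq, coeff_sub]
  calc ENNReal.ofReal (sobolevFactor d) * seqNorm γ (coeff (u (n * τ)) - coeff (lri τ u₀ n))
      ≤ ENNReal.ofReal (sobolevFactor d) * ENNReal.ofReal (X * τ ^ 2) := by
        gcongr; exact seqNorm_error_le hγ hu hbound hτ hτ1 (by nlinarith) hn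
    _ = ENNReal.ofReal (sobolevFactor d * (X * τ ^ 2)) := (ENNReal.ofReal_mul hc.le).symm
    _ ≤ ENNReal.ofReal ((sobolevFactor d * X + 1) * τ ^ 2) :=
        ENNReal.ofReal_le_ofReal (by nlinarith [sq_nonneg τ])
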